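/- **Setting.** Let $A$ be a finite set of $n\ge 2$ agents and let $Q$ be a probability distribution on signal profiles $\sigma\in\{0,1\}^A$. Assume that $Q$ is *symmetric*: $\Pr[\sigma_j=s'\mid\sigma_i=s]$ is the same number $q(s'|s)$ for all ordered pairs $i\neq j$. Let $q(s)$ be the expected fraction of agents with signal $s$. Assume that $Q$ is *positively correlated*, $q(s|s)>q(s)$ for $s=0,1$, and *signal asymmetric*, $q(0)\ne q(1)$, with $q(1|1)>q(0|0)$. A (mixed) strategy of an agent assigns to each signal $b$ a probability of reporting $1$. A *peer prediction mechanism* is given by a payoff matrix $h=\begin{pmatrix}h_{1,1}&h_{1,0}\\h_{0,1}&h_{0,0}\end{pmatrix}$ with $h_{t,r}=PS(t,q(1|r))$ for a strictly proper scoring rule $PS$ for a binary outcome (the second argument is the predicted probability of the outcome $1$, in $[0,1]$). Each agent is paired with a uniformly random other agent; an agent who reports $r$ and is paired with an agent who reports $t$ is paid $h_{t,r}$. Let $\nu^h$ denote expected payoff. Equilibria are Bayesian Nash equilibria, among all (also asymmetric) profiles of mixed strategies. Let $\mathbf T$, $\mathbf 0$, $\mathbf 1$ be the profiles in which all agents tell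 the truth, always report $0$, always report $1$. The *gap* of $h$ is $$\Delta_Q(h)=\min_{\theta,i}\bigl(\nu^h_i(\mathbf T)-\nu^h_i(\theta)\bigr),$$ over all agents $i$ and all equilibria $\theta\notin\{\mathbf T,\mathbf 0,\mathbf 1\}$, i.e. the payoff of truth-telling minus the maximal payoff of another informative equilibrium. Let $\mathcal U$ be the set of peer prediction mechanisms with $\min_{t,r}h_{t,r}=0$ and $\max_{t,r}h_{t,r}=1$, and $\Delta^*(Q)=\sup_{h\in\mathcal U}\Delta_Q(h)$. Put $S=\sqrt{q(0|0)\,q(1|0)\,q(0|1)\,q(1|1)}$ and $$q^*_{a,o}=\frac{q(1|0)q(1|1)-S}{q(1|1)-q(0|0)},$$ $$\Delta^*_a=\frac{q(0|1)\,(q(0|0)q(1|0)-S)\,(S-q(0|1)q(1|1))}{(q(0|1)+q(1|0))\,q(1|1)\,(q(1|1)-q(0|0))\,(S+q(1|1)-q(0|0)-q(1|0)q(1|1))},$$ $$\Delta^*_b=\frac{(q(1|1)-q(0|0))\Bigl(q(0|0)q(1|0)(q(1|1)-q(0|1))-\sqrt{q(0|0)q(1|0)(q(1|1)-q(1|0))(q(1|1)-q(0|0))}\Bigr)}{(q(1|0)+q(0|1))\,q(1|0)\,q(1|1)\,q(0|0)},$$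 $$\iota_a=\frac{q(0|1)}{q(1|0)+q(0|1)}\cdot\frac{q(1|0)(q(1|1)-q(0|0))(q(0|0)-q(1|0))}{q(0|0)\,\bigl(q(1|0)q(1|1)-(q(1|1)-q(0|0))q(0|0)\bigr)},$$ $$\kappa_a=\frac{q(0|1)}{q(1|0)+q(0|1)}\cdot\frac{(q(1|1)-q(0|0))(q(0|0)-q(1|0))}{q(1|1)(1-q(0|0))}.$$ Define the regions - $Q\in R_1$ iff $q(0|0)\le q(1|0)$, or $q(0|0)>q(1|0)$ and $q^*_{a,o}>q(0|0)$ and $\Delta^*_a\ge\Delta^*_b$; - $Q\in R_2$ iff $q(0|0)>q(1|0)$, and either $q^*_{a,o}>q(0|0)$ and $\Delta^*_a<\Delta^*_b$, or $q^*_{a,o}\le q(0|0)$ and $\min\{\iota_a,\kappa_a\}\le\Delta^*_b$; - $Q\in R_3$ iff $q(0|0)>q(1|0)$ and $q^*_{a,o}\le q(0|0)$ and $\min\{\iota_a,\kappa_a\}>\Delta^*_b$. Let $$M_1=\begin{pmatrix}\zeta&0\\0&1\end{pmatrix},\quad M_2=\begin{pmatrix}1&0\\0&\eta\end{pmatrix},\quad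 M_3(\epsilon)=\begin{pmatrix}\zeta(\epsilon)&\delta(\epsilon)\\0&1\end{pmatrix},$$ $$\zeta=\sqrt{\frac{q(0|0)q(0|1)}{q(1|0)q(1|1)}},\qquad \eta=\frac1{q(1|1)}\left(\sqrt{\frac{(q(1|1)-q(1|0))(q(1|1)-q(0|0))}{q(0|0)q(1|0)}}+q(0|1)\right),$$ and, with $u=q(0|0)+\epsilon$, $$\zeta(\epsilon)=\frac{q(0|0)q(0|1)}{q(0|0)q(0|1)u+q(1|0)(q(1|1)-q(1|1)u)},\qquad \delta(\epsilon)=\frac{q(1|0)q(1|1)(u-1)^2-q(0|0)q(0|1)u^2}{u\,\bigl(q(1|0)q(1|1)(u-1)-q(0|0)q(0|1)u\bigr)}.$$ **Theorem.** $Q$ lies in exactly one of $R_1,R_2,R_3$. For every peer prediction mechanism the minimum defining the gap exists. The set of gaps over $\mathcal U$ is nonempty and bounded above, so that $\Delta^*(Q)$ is its least upper bound; it is also the least upper bound of the gaps over all peer prediction mechanisms with all payoffs in $[0,1]$. Moreover: 1. If $Q\in R_1$, then $M_1\in\mathcal U$ and $\Delta_Q(M_1)=\Delta^*(Q)$. 2.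 If $Q\in R_2$, then $M_2\in\mathcal U$ and $\Delta_Q(M_2)=\Delta^*(Q)$. 3. If $Q\in R_3$, then no peer prediction mechanism with payoffs in $[0,1]$ has gap $\Delta^*(Q)$; $M_3(\epsilon)\in\mathcal U$ for every $\epsilon>0$ with $q(0|0)+\epsilon<q(1|1)$; and $\lim_{\epsilon\to0^+}\Delta_Q(M_3(\epsilon))=\Delta^*(Q)$. -/

import Mathlib

open Filter Topology

noncomputable section

namespace PeerPrediction

/-! ### The prior

Signals and reports are elements of `Fin 2`.  The agents form a finite type `A`, and a prior is a
probability vector `Q` on the set `A → Fin 2` of signal profiles. -/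

section Prior

variable {A : Type*} [Fintype A] [DecidableEq A]

/-- `Pr[σ_i = s]`. -/
def signalProb (Q : (A → Fin 2) → ℝ) (i : A) (s : Fin 2) : ℝ :=
  ∑ σ : A → Fin 2, if σ i = s then Q σ else 0

/-- `Pr[σ_j = s' | σ_i = s]`. -/
def condProb (Q : (A → Fin 2) → ℝ) (i j : A) (s' s : Fin 2) : ℝ :=
  (∑ σ : A → Fin 2, if σ j = s' ∧ σ i = s then Q σ else 0) / signalProb Q i s

/-- A symmetric prior: the inference that a signal allows about the signal of another agent does
not depend on the identities of the two agents. -/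
def IsSymmetric (Q : (A → Fin 2) → ℝ) : Prop :=
  ∀ i j k l : A, i ≠ j → k ≠ l → ∀ s s' : Fin 2, condProb Q i j s' s = condProb Q k l s' s

/-- `q(s)`: the expected fraction of agents with signal `s`. -/
def frequency (Q : (A → Fin 2) → ℝ) (s : Fin 2) : ℝ :=
  (∑ i : A, signalProb Q i s) / (Fintype.card A : ℝ)

/-- `q(s'|s)`, written `posterior Q s' s`: the value of `Pr[σ_j = s' | σ_i = s]`, averaged over the
ordered pairs of distinct agents (for a symmetric prior all these values agree). -/
def posterior (Q : (A → Fin 2) → ℝ) (s' s : Fin 2) : ℝ :=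
  (∑ p ∈ (Finset.univ : Finset A).offDiag, condProb Q p.1 p.2 s' s) /
    (((Finset.univ : Finset A).offDiag.card : ℕ) : ℝ)

/-- `q(s|s) > q(s)` for each signal `s`. -/
def IsPositivelyCorrelated (Q : (A → Fin 2) → ℝ) : Prop :=
  ∀ s : Fin 2, frequency Q s < posterior Q s s

/-- `q(0) ≠ q(1)`. -/
def IsSignalAsymmetric (Q : (A → Fin 2) → ℝ) : Prop :=
  frequency Q 0 ≠ frequency Q 1

end Prior

/-! ### Strategies, payoffs and equilibria

A payoff function matrix is a map `h : Fin 2 → Fin 2 → ℝ`: an agent who reports `r` and is paired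
with an agent who reports `t` is paid `h t r`. -/

/-- A mixed strategy, given by the probability `θ b` of reporting `1` on signal `b`. -/
abbrev Strategy : Type := Fin 2 → unitInterval

/-- `θ(r|b)`, the probability of reporting `r` on signal `b`. -/
def Strategy.prob (θ : Strategy) (r b : Fin 2) : ℝ :=
  if r = 1 then (θ b : ℝ) else 1 - (θ b : ℝ)

/-- Truth-telling. -/
def truthful : Strategy := fun b => if b = 1 then 1 else 0

/-- Always reporting `0`. -/
def allZero : Strategy := fun _ => 0

/-- Always reporting `1`. -/
def allOne : Strategy := fun _ => 1

section Game

variable {A : Type*} [Fintype A] [DecidableEq A]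

/-- The expected payment of agent `i`, who is paired with a uniformly random other agent `j`.
The expectation is over the signals, the pairing and the independent randomizations of the two
paired agents. -/
def expectedPayoff (Q : (A → Fin 2) → ℝ) (h : Fin 2 → Fin 2 → ℝ) (θ : A → Strategy) (i : A) : ℝ :=
  ∑ σ : A → Fin 2, Q σ *
    ((∑ j ∈ Finset.univ.erase i, ∑ r : Fin 2, ∑ t : Fin 2,
        (θ i).prob r (σ i) * (θ j).prob t (σ j) * h t r) / ((Fintype.card A : ℝ) - 1))

/-- Bayesian Nash equilibrium (symmetric or not). -/
def IsEquilibrium (Q : (A → Fin 2) → ℝ) (h : Fin 2 → Fin 2 → ℝ) (θ : A → Strategy) : Prop :=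
  ∀ (i : A) (τ : Strategy),
    expectedPayoff Q h (Function.update θ i τ) i ≤ expectedPayoff Q h θ i

/-- The advantages of truth-telling over the other informative equilibria: all differences between
the payoff of an agent under truth-telling and the payoff of the same agent in an equilibrium that
is not one of the profiles "all tell the truth", "all report `0`", "all report `1`". -/
def advantages (Q : (A → Fin 2) → ℝ) (h : Fin 2 → Fin 2 → ℝ) : Set ℝ :=
  {x | ∃ θ : A → Strategy, IsEquilibrium Q h θ ∧
    θ ≠ (fun _ => truthful) ∧ θ ≠ (fun _ => allZero) ∧ θ ≠ (fun _ => allOne) ∧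
    ∃ i : A, x = expectedPayoff Q h (fun _ => truthful) i - expectedPayoff Q h θ i}

/-- `Δ_Q(h)`: the payoff of truth-telling minus the maximal payoff of another informative
equilibrium, that is, the minimum of the advantages. -/
def gap (Q : (A → Fin 2) → ℝ) (h : Fin 2 → Fin 2 → ℝ) : ℝ :=
  sInf (advantages Q h)

end Game

/-! ### Peer prediction mechanisms -/

/-- The expected score `PS(p, p')` of the prediction `p'` when the outcome is `1` with
probability `p`.  A prediction is the probability of the outcome `1`. -/
def expectedScore (PS : Fin 2 → ℝ → ℝ) (p p' : ℝ) : ℝ :=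
  p * PS 1 p' + (1 - p) * PS 0 p'

/-- Strictly proper scoring rules for a binary outcome. -/
def IsStrictlyProper (PS : Fin 2 → ℝ → ℝ) : Prop :=
  ∀ p ∈ Set.Icc (0 : ℝ) 1, ∀ p' ∈ Set.Icc (0 : ℝ) 1, p' ≠ p →
    expectedScore PS p p' < expectedScore PS p p

section Mechanisms

variable {A : Type*} [Fintype A] [DecidableEq A]

/-- `h` is the payoff function matrix of a peer prediction mechanism for `Q`:
`h t r = PS(t, q(1|r))` for a strictly proper scoring rule `PS`. -/
def IsPeerPrediction (Q : (A → Fin 2) → ℝ) (h : Fin 2 → Fin 2 → ℝ) : Prop :=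
  ∃ PS : Fin 2 → ℝ → ℝ, IsStrictlyProper PS ∧ ∀ t r : Fin 2, h t r = PS t (posterior Q 1 r)

/-- Peer prediction mechanisms with all payoffs in `[0, 1]`. -/
def boundedMechanisms (Q : (A → Fin 2) → ℝ) : Set (Fin 2 → Fin 2 → ℝ) :=
  {h | IsPeerPrediction Q h ∧ ∀ t r : Fin 2, 0 ≤ h t r ∧ h t r ≤ 1}

/-- Peer prediction mechanisms whose minimal payoff is `0` and whose maximal payoff is `1`. -/
def normalizedMechanisms (Q : (A → Fin 2) → ℝ) : Set (Fin 2 → Fin 2 → ℝ) :=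
  {h | h ∈ boundedMechanisms Q ∧ (∃ t r : Fin 2, h t r = 0) ∧ (∃ t r : Fin 2, h t r = 1)}

/-- `Δ*(Q)`. -/
def optimalGap (Q : (A → Fin 2) → ℝ) : ℝ :=
  sSup (gap Q '' normalizedMechanisms Q)

end Mechanisms

/-! ### Regions and explicit mechanisms

In what follows `q s' s` stands for `q(s'|s)`. -/

section Explicit

variable (q : Fin 2 → Fin 2 → ℝ)

/-- `q*_{a,o}`. -/
def qStarA : ℝ :=
  (q 1 0 * q 1 1 - √(q 1 0 * q 0 1 * q 0 0 * q 1 1)) / (q 1 1 - q 0 0)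

/-- `Δ*_a`. -/
def deltaA : ℝ :=
  (q 0 1 * (q 0 0 * q 1 0 - √(q 0 0 * q 1 0 * q 0 1 * q 1 1)) *
      (√(q 0 0 * q 1 0 * q 0 1 * q 1 1) - q 0 1 * q 1 1)) /
    ((q 0 1 + q 1 0) * q 1 1 * (q 1 1 - q 0 0) *
      (√(q 0 0 * q 1 0 * q 0 1 * q 1 1) + q 1 1 - q 0 0 - q 1 0 * q 1 1))

/-- `Δ*_b`. -/
def deltaB : ℝ :=
  ((q 1 1 - q 0 0) * (q 0 0 * q 1 0 * (q 1 1 - q 0 1) -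
      √(q 0 0 * q 1 0 * (q 1 1 - q 1 0) * (q 1 1 - q 0 0)))) /
    ((q 1 0 + q 0 1) * q 1 0 * q 1 1 * q 0 0)

/-- `ι_a(q(0|0))`. -/
def iotaA : ℝ :=
  q 0 1 / (q 1 0 + q 0 1) *
    ((q 1 0 * (q 1 1 - q 0 0) * (q 0 0 - q 1 0)) /
      (q 0 0 * (q 1 0 * q 1 1 - (q 1 1 - q 0 0) * q 0 0)))

/-- `κ_a(q(0|0))`. -/
def kappaA : ℝ :=
  q 0 1 / (q 1 0 + q 0 1) *
    (((q 1 1 - q 0 0) * (q 0 0 - q 1 0)) / (q 1 1 * (1 - q 0 0)))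

/-- The region `R₁`. -/
def R1 : Prop :=
  q 0 0 ≤ q 1 0 ∨ (q 1 0 < q 0 0 ∧ q 0 0 < qStarA q ∧ deltaB q ≤ deltaA q)

/-- The region `R₂`. -/
def R2 : Prop :=
  (q 1 0 < q 0 0 ∧ q 0 0 < qStarA q ∧ deltaA q < deltaB q) ∨
    (q 1 0 < q 0 0 ∧ qStarA q ≤ q 0 0 ∧ min (iotaA q) (kappaA q) ≤ deltaB q)

/-- The region `R₃`. -/
def R3 : Prop :=
  q 1 0 < q 0 0 ∧ qStarA q ≤ q 0 0 ∧ deltaB q < min (iotaA q) (kappaA q)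

/-- The payoff function matrix with rows `(h₁₁, h₁₀)` and `(h₀₁, h₀₀)`; the first index is the
report of the paired agent, the second one is the agent's own report. -/
def payoffMatrix (h11 h10 h01 h00 : ℝ) : Fin 2 → Fin 2 → ℝ :=
  ![![h00, h01], ![h10, h11]]

/-- `ζ(Q)`. -/
def zeta : ℝ := √((q 0 0 * q 0 1) / (q 1 0 * q 1 1))

/-- `η(Q)`. -/
def eta : ℝ :=
  1 / q 1 1 * (√(((q 1 1 - q 1 0) * (q 1 1 - q 0 0)) / (q 0 0 * q 1 0)) + q 0 1)

/-- `ζ(Q, ε)`. -/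
def zetaEps (ε : ℝ) : ℝ :=
  (q 0 0 * q 0 1) /
    (q 0 0 * q 0 1 * (q 0 0 + ε) + q 1 0 * (q 1 1 - q 1 1 * (q 0 0 + ε)))

/-- `δ(Q, ε)`. -/
def deltaEps (ε : ℝ) : ℝ :=
  (q 1 0 * q 1 1 * (q 0 0 + ε - 1) ^ 2 - q 0 0 * q 0 1 * (q 0 0 + ε) ^ 2) /
    ((q 0 0 + ε) * (q 1 0 * q 1 1 * (q 0 0 + ε - 1) - q 0 0 * q 0 1 * (q 0 0 + ε)))

/-- `M₁(Q)`. -/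
def M1 : Fin 2 → Fin 2 → ℝ :=
  payoffMatrix (zeta q) 0
               0        1

/-- `M₂(Q)`. -/
def M2 : Fin 2 → Fin 2 → ℝ :=
  payoffMatrix 1 0
               0 (eta q)

/-- `M₃(Q, ε)`. -/
def M3 (ε : ℝ) : Fin 2 → Fin 2 → ℝ :=
  payoffMatrix (zetaEps q ε) (deltaEps q ε)
               0             1

end Explicit

end PeerPrediction

end

open PeerPrediction

/-! Write a = q(1|0) and b = q(1|1), so that q(0|0) = 1 - a, q(0|1) = 1 - b and a + b > 1. For a
fixed report the payment is affine in the probability y that the partner reports 1. Strict propriety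
says exactly that the two resulting lines cross at some q in (a, b), report 0 being better on the
left and report 1 on the right (`exists_eq_mech`, `isPeerPrediction_mech`). With slopes -u and v a
mechanism is a triple (q, u, v), u + v > 0, and a height w that cancels in payoff differences.

The equilibria depend on q alone. The game is one of coordination, which forces all agents to play
alike, and besides the three excluded profiles at most six remain (`symmetric_equilibrium_cases`).
The advantage of truth-telling over each is linear in (u, v). Two equilibria always exist: mixing on
signal 1 while reporting 0 on signal 0, and mixing on signal 0 while reporting 1 on signal 1.
"Always lie" is an equilibrium exactly for q ≤ 1 - a. At the explicit mechanisms the other three do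
not decide the minimum (`gap_mech_eq`).

Payoffs in [0, 1] force u, v ≤ 1, (u + v)q ≤ 1 and (u + v)(1 - q) ≤ 1, so for fixed q the gap is
bounded by small linear programs. The two mixing equilibria give the bounds κ(q), rising up to q*,
and ι(q), falling beyond q*, which agree at q* = `crossing a b` = q*_{a,o}. Hence every gap is at
most Δ*_a = κ(q*)/(1 - b + a), and `M1` attains this if q* > 1 - a, where lying is no equilibrium.

If q* ≤ 1 - a, there are two ranges. For q ≤ 1 - a lying counts, and the bounds λ(q) and μ(q) meet
at q = η/(1 + η), which gives Δ*_b, attained by `M2`. For q > 1 - a the gap is less than ι(1 - a)/(1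
- b + a); `M3` with crossing point 1 - a + ε approaches this value, but it is not attained, because
at q = 1 - a lying is an equilibrium again. The regions compare these values. -/

namespace PeerPrediction

/-! ### Posteriors of a symmetric prior. -/

section Prior

variable {A : Type*} [Fintype A] [DecidableEq A]

/-- `Pr[σ_j = s', σ_i = s]`. -/
noncomputable def jointProb (Q : (A → Fin 2) → ℝ) (i j : A) (s' s : Fin 2) : ℝ :=
  ∑ σ : A → Fin 2, if σ j = s' ∧ σ i = s then Q σ else 0

lemma jointProb_comm (Q : (A → Fin 2) → ℝ) (i j : A) (s' s : Fin 2) :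
    jointProb Q i j s' s = jointProb Q j i s s' := by
  simp only [jointProb, and_comm]

lemma jointProb_add (Q : (A → Fin 2) → ℝ) (i j : A) (s : Fin 2) :
    jointProb Q i j 0 s + jointProb Q i j 1 s = signalProb Q i s := by
  simp only [jointProb, signalProb, ← Finset.sum_add_distrib]
  refine Finset.sum_congr rfl fun σ _ => ?_
  rcases Fin.exists_fin_two.mp ⟨σ j, rfl⟩ with h | h <;> simp [h]

lemma jointProb_nonneg {Q : (A → Fin 2) → ℝ} (hQ : Q ∈ stdSimplex ℝ (A → Fin 2)) (i j : A)
    (s' s : Fin 2) : 0 ≤ jointProb Q i j s' s :=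
  Finset.sum_nonneg fun σ _ => by
    split_ifs
    exacts [hQ.1 σ, le_rfl]

lemma signalProb_nonneg {Q : (A → Fin 2) → ℝ} (hQ : Q ∈ stdSimplex ℝ (A → Fin 2)) (i : A)
    (s : Fin 2) : 0 ≤ signalProb Q i s :=
  Finset.sum_nonneg fun σ _ => by
    split_ifs
    exacts [hQ.1 σ, le_rfl]

lemma signalProb_add {Q : (A → Fin 2) → ℝ} (hQ : Q ∈ stdSimplex ℝ (A → Fin 2)) (i : A) :
    signalProb Q i 0 + signalProb Q i 1 = 1 := by
  rw [← hQ.2]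
  simp only [signalProb, ← Finset.sum_add_distrib]
  refine Finset.sum_congr rfl fun σ _ => ?_
  rcases Fin.exists_fin_two.mp ⟨σ i, rfl⟩ with h | h <;> simp [h]

lemma frequency_nonneg {Q : (A → Fin 2) → ℝ} (hQ : Q ∈ stdSimplex ℝ (A → Fin 2)) (s : Fin 2) :
    0 ≤ frequency Q s :=
  div_nonneg (Finset.sum_nonneg fun i _ => signalProb_nonneg hQ i s) (Nat.cast_nonneg _)

lemma posterior_eq_condProb {Q : (A → Fin 2) → ℝ} (hsymm : IsSymmetric Q) {i j : A} (hij : i ≠ j)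
    (s' s : Fin 2) : posterior Q s' s = condProb Q i j s' s := by
  have hne : ((Finset.univ : Finset A).offDiag.card : ℝ) ≠ 0 := by
    have : (i, j) ∈ (Finset.univ : Finset A).offDiag := by simp [hij]
    exact_mod_cast (Finset.card_pos.mpr ⟨_, this⟩).ne'
  have hsum : ∑ p ∈ (Finset.univ : Finset A).offDiag, condProb Q p.1 p.2 s' s =
      ∑ _p ∈ (Finset.univ : Finset A).offDiag, condProb Q i j s' s :=
    Finset.sum_congr rfl fun p hp =>
      hsymm p.1 p.2 i j (by simpa using (Finset.mem_offDiag.mp hp).2.2) hij s s'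
  rw [posterior, hsum, Finset.sum_const, nsmul_eq_mul, mul_div_cancel_left₀ _ hne]

/-- The facts about a symmetric, positively correlated and signal asymmetric prior on which the
analysis of the game rests; `a = q(1|0)` and `b = q(1|1)`. -/
structure HasPosteriors (Q : (A → Fin 2) → ℝ) (a b : ℝ) : Prop where
  pos : 0 < a
  lt : a < b
  lt_one : b < 1
  one_lt_add : 1 < a + b
  posterior_one_zero : posterior Q 1 0 = a
  posterior_one_one : posterior Q 1 1 = b
  posterior_zero_zero : posterior Q 0 0 = 1 - a
  posterior_zero_one : posterior Q 0 1 = 1 - b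
  signalProb_one : ∀ i, signalProb Q i 1 = a / (1 - b + a)
  signalProb_zero : ∀ i, signalProb Q i 0 = (1 - b) / (1 - b + a)
  jointProb_eq : ∀ i j, i ≠ j → ∀ s' s,
    jointProb Q i j s' s = posterior Q s' s * signalProb Q i s

lemma hasPosteriors [Nontrivial A] {Q : (A → Fin 2) → ℝ} (hQ : Q ∈ stdSimplex ℝ (A → Fin 2))
    (hsymm : IsSymmetric Q) (hcorr : IsPositivelyCorrelated Q)
    (hlt : posterior Q 0 0 < posterior Q 1 1) :
    HasPosteriors Q (posterior Q 1 0) (posterior Q 1 1) := by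
  have hpost : ∀ s, 0 < posterior Q s s := fun s => (frequency_nonneg hQ s).trans_lt (hcorr s)
  -- A null signal would turn `condProb` into a division by zero, hence 0, against `hpost`.
  have hne : ∀ i s, signalProb Q i s ≠ 0 := fun i s h0 => by
    obtain ⟨j, hj⟩ := exists_ne i
    have := hpost s
    rw [posterior_eq_condProb hsymm hj.symm, condProb, h0, div_zero] at this
    exact this.false
  have hjoint : ∀ i j, i ≠ j → ∀ s' s,
      jointProb Q i j s' s = posterior Q s' s * signalProb Q i s := fun i j hij s' s => by
    rw [posterior_eq_condProb hsymm hij, condProb, div_mul_cancel₀ _ (hne i s), jointProb]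
  -- The event that both agents have signal s has probability q(s|s) Pr[σ_i = s] and also q(s|s)
  -- Pr[σ_j = s].
  have hconst : ∀ i j s, signalProb Q i s = signalProb Q j s := fun i j s => by
    rcases eq_or_ne i j with rfl | hij
    · rfl
    · have h := jointProb_comm Q i j s s
      rw [hjoint i j hij, hjoint j i hij.symm] at h
      exact mul_left_cancel₀ (hpost s).ne' h
  have hfreq : ∀ i s, frequency Q s = signalProb Q i s := fun i s => by
    rw [frequency, Finset.sum_congr rfl fun j _ => hconst j i s, Finset.sum_const, nsmul_eq_mul,
      Finset.card_univ, mul_div_cancel_left₀]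
    exact_mod_cast Fintype.card_ne_zero
  have i₀ : A := Classical.arbitrary A
  obtain ⟨j₀, hj₀⟩ := exists_ne i₀
  have hadd : ∀ s, posterior Q 0 s + posterior Q 1 s = 1 := fun s => by
    have h := jointProb_add Q i₀ j₀ s
    rw [hjoint _ _ hj₀.symm, hjoint _ _ hj₀.symm, ← add_mul] at h
    exact mul_right_cancel₀ (hne i₀ s) (by rw [h, one_mul])
  have hnonneg : 0 ≤ posterior Q 0 1 := by
    have h := jointProb_nonneg hQ i₀ j₀ 0 1
    rw [hjoint _ _ hj₀.symm] at h
    exact nonneg_of_mul_nonneg_left h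
      (lt_of_le_of_ne (signalProb_nonneg hQ i₀ 1) (hne i₀ 1).symm)
  have hsum := signalProb_add hQ i₀
  have hbayes : posterior Q 1 0 * signalProb Q i₀ 0 + posterior Q 1 1 * signalProb Q i₀ 1 =
      signalProb Q i₀ 1 := by
    have h := jointProb_add Q j₀ i₀ 1
    rw [jointProb_comm, jointProb_comm Q j₀ i₀ 1 1, hjoint _ _ hj₀.symm, hjoint _ _ hj₀.symm,
      hconst j₀ i₀] at h
    exact h
  have h0 := hadd 0
  have h1 := hadd 1
  have hc0 := hcorr 0
  have hc1 := hcorr 1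
  rw [hfreq i₀] at hc0 hc1
  set p := signalProb Q i₀ 1 with hp
  have hp0 : signalProb Q i₀ 0 = 1 - p := by linarith
  rw [hp0] at hbayes hc0
  have hp1 : p < 1 := by
    have := lt_of_le_of_ne (signalProb_nonneg hQ i₀ 0) (hne i₀ 0).symm
    linarith
  -- q(1|0) = 1 - q(0|0) > 1 - q(1|1) = q(0|1) ≥ 0.
  have ha : 0 < posterior Q 1 0 := by linarith
  have hb : posterior Q 1 1 < 1 := by
    by_contra hb
    have hb1 : posterior Q 1 1 = 1 := by linarith
    rw [hb1] at hbayes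
    have : 0 < posterior Q 1 0 * (1 - p) := mul_pos ha (by linarith)
    linarith
  have hc : 0 < 1 - posterior Q 1 1 + posterior Q 1 0 := by linarith
  refine ⟨ha, by linarith, hb, by linarith, rfl, rfl, by linarith, by linarith, fun i => ?_,
    fun i => ?_, hjoint⟩
  · rw [hconst i i₀, ← hp, eq_div_iff hc.ne']
    linarith
  · rw [hconst i i₀, hp0, eq_div_iff hc.ne']
    linarith

end Prior

/-! ### Payoffs against an average opponent. -/

/-- The expected payment of a report `r` if the paired agent reports `1` with probability `y`. -/
def line (h : Fin 2 → Fin 2 → ℝ) (r : Fin 2) (y : ℝ) : ℝ := y * h 1 r + (1 - y) * h 0 r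

/-- The probability that an agent playing `(x₀, x₁)` reports `1`, if its signal is `1` with
probability `p`. -/
def belief (p x₀ x₁ : ℝ) : ℝ := (1 - p) * x₀ + p * x₁

/-- The expected payment of the strategy `(t₀, t₁)` against agents that play `(x₀, x₁)` on
average. -/
noncomputable def payoffAgainst (a b : ℝ) (h : Fin 2 → Fin 2 → ℝ) (t₀ t₁ x₀ x₁ : ℝ) : ℝ :=
  ((1 - b) * ((1 - t₀) * line h 0 (belief a x₀ x₁) + t₀ * line h 1 (belief a x₀ x₁)) +
    a * ((1 - t₁) * line h 0 (belief b x₀ x₁) + t₁ * line h 1 (belief b x₀ x₁))) / (1 - b + a)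

lemma Strategy.eq_iff (x z : Strategy) : x = z ↔ (x 0 : ℝ) = z 0 ∧ (x 1 : ℝ) = z 1 := by
  refine ⟨fun h => h ▸ ⟨rfl, rfl⟩, fun h => funext fun s => ?_⟩
  fin_cases s
  exacts [Subtype.ext h.1, Subtype.ext h.2]

section Payoff

variable {A : Type*} [Fintype A] [DecidableEq A]

/-- The average strategy of the other agents. -/
noncomputable def others (θ : A → Strategy) (i : A) (s : Fin 2) : ℝ :=
  (∑ j ∈ Finset.univ.erase i, (θ j s : ℝ)) / ((Fintype.card A : ℝ) - 1)

lemma sum_mul_eq_sum_jointProb (Q : (A → Fin 2) → ℝ) (i j : A) (F : Fin 2 → Fin 2 → ℝ) :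
    ∑ σ : A → Fin 2, Q σ * F (σ i) (σ j) = ∑ s, ∑ s', jointProb Q i j s' s * F s s' := by
  simp only [jointProb, Fin.sum_univ_two, Finset.sum_mul, ← Finset.sum_add_distrib]
  refine Finset.sum_congr rfl fun σ _ => ?_
  rcases Fin.exists_fin_two.mp ⟨σ j, rfl⟩ with h | h <;>
  rcases Fin.exists_fin_two.mp ⟨σ i, rfl⟩ with h' | h' <;> simp [h, h']

lemma sum_others [Nontrivial A] (θ : A → Strategy) (i : A) (C D₀ D₁ : ℝ) :
    (∑ j ∈ Finset.univ.erase i, (C + D₀ * (θ j 0 : ℝ) + D₁ * (θ j 1 : ℝ))) /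
      ((Fintype.card A : ℝ) - 1) = C + D₀ * others θ i 0 + D₁ * others θ i 1 := by
  have hn : (1 : ℝ) < Fintype.card A := by exact_mod_cast Fintype.one_lt_card
  have hcard : ((Finset.univ.erase i).card : ℝ) = (Fintype.card A : ℝ) - 1 := by
    rw [Finset.card_erase_of_mem (Finset.mem_univ i), Finset.card_univ,
      Nat.cast_sub Fintype.card_pos, Nat.cast_one]
  have hne : (Fintype.card A : ℝ) - 1 ≠ 0 := by linarith
  rw [Finset.sum_add_distrib, Finset.sum_add_distrib, Finset.sum_const, nsmul_eq_mul, hcard,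
    ← Finset.mul_sum, ← Finset.mul_sum, others, others]
  field_simp

lemma others_update (θ : A → Strategy) (i : A) (τ : Strategy) :
    others (Function.update θ i τ) i = others θ i := by
  funext s
  rw [others, others]
  congr 1
  exact Finset.sum_congr rfl fun j hj => by
    rw [Function.update_of_ne (Finset.ne_of_mem_erase hj)]

lemma others_const [Nontrivial A] (x : Strategy) (i : A) (s : Fin 2) :
    others (fun _ : A => x) i s = x s := by
  have h := sum_others (fun _ : A => x) i (x s) 0 0
  simpa [others] using h

lemma others_sub_others [Nontrivial A] (θ : A → Strategy) (i j : A) (s : Fin 2) :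
    others θ i s - others θ j s = ((θ j s : ℝ) - θ i s) / ((Fintype.card A : ℝ) - 1) := by
  have h : ∀ i, ∑ j ∈ Finset.univ.erase i, (θ j s : ℝ) = ∑ j, (θ j s : ℝ) - θ i s := fun i => by
    rw [← Finset.add_sum_erase _ _ (Finset.mem_univ i)]
    ring
  rw [others, others, h, h]
  ring

/-- The payment from one partner is affine in that partner's strategy, so facing a uniformly random
partner amounts to facing the average strategy. -/
lemma HasPosteriors.expectedPayoff_eq [Nontrivial A] {Q : (A → Fin 2) → ℝ} {a b : ℝ}
    (hQ : HasPosteriors Q a b) (h : Fin 2 → Fin 2 → ℝ) (θ : A → Strategy) (i : A) :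
    expectedPayoff Q h θ i =
      payoffAgainst a b h (θ i 0) (θ i 1) (others θ i 0) (others θ i 1) := by
  have hc : 1 - b + a ≠ 0 := by linarith [hQ.pos, hQ.lt_one]
  have hpair : ∀ j ∈ Finset.univ.erase i, ∑ σ : A → Fin 2, Q σ * (∑ r : Fin 2, ∑ t : Fin 2,
      (θ i).prob r (σ i) * (θ j).prob t (σ j) * h t r) =
      payoffAgainst a b h (θ i 0) (θ i 1) (θ j 0) (θ j 1) := fun j hj => by
    rw [sum_mul_eq_sum_jointProb Q i j fun s s' => ∑ r : Fin 2, ∑ t : Fin 2,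
      (θ i).prob r s * (θ j).prob t s' * h t r]
    simp only [hQ.jointProb_eq i j (Finset.ne_of_mem_erase hj).symm, Fin.sum_univ_two,
      hQ.posterior_one_zero, hQ.posterior_one_one, hQ.posterior_zero_zero, hQ.posterior_zero_one,
      hQ.signalProb_one, hQ.signalProb_zero, Strategy.prob, payoffAgainst, line, belief]
    simp only [Fin.isValue, zero_ne_one, if_true, if_false]
    field_simp
    ring
  have hlin : ∀ x₀ x₁ : ℝ, payoffAgainst a b h (θ i 0) (θ i 1) x₀ x₁ =
      payoffAgainst a b h (θ i 0) (θ i 1) 0 0 +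
      (payoffAgainst a b h (θ i 0) (θ i 1) 1 0 - payoffAgainst a b h (θ i 0) (θ i 1) 0 0) * x₀ +
      (payoffAgainst a b h (θ i 0) (θ i 1) 0 1 - payoffAgainst a b h (θ i 0) (θ i 1) 0 0) * x₁ :=
    fun x₀ x₁ => by
      simp only [payoffAgainst, line, belief]
      field_simp
      ring
  rw [hlin, ← sum_others]
  simp only [← hlin]
  rw [← Finset.sum_congr rfl hpair, expectedPayoff, Finset.sum_comm, Finset.sum_div]
  refine Finset.sum_congr rfl fun σ _ => ?_
  rw [← Finset.mul_sum, mul_div_assoc]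

end Payoff

/-! ### Mechanisms as pairs of crossing lines. -/

/-- The payoff function matrix for which the expected payments of the two reports cross at
`(q, w)` and have the slopes `-u` (report `0`) and `v` (report `1`). -/
def mech (q u v w : ℝ) : Fin 2 → Fin 2 → ℝ :=
  payoffMatrix (w + v * (1 - q)) (w - u * (1 - q)) (w - v * q) (w + u * q)

lemma line_mech_zero (q u v w y : ℝ) : line (mech q u v w) 0 y = w - u * (y - q) := by
  simp only [line, mech, payoffMatrix, Matrix.cons_val_zero, Matrix.cons_val_one]
  ring

lemma line_mech_one (q u v w y : ℝ) : line (mech q u v w) 1 y = w + v * (y - q) := by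
  simp only [line, mech, payoffMatrix, Matrix.cons_val_zero, Matrix.cons_val_one]
  ring

/-- The probability `t` of reporting `1` is optimal if `d` is a positive multiple of the advantage
of the report `1`. -/
def IsBestReply (d t : ℝ) : Prop := (0 < d → t = 1) ∧ (d < 0 → t = 0)

lemma IsBestReply.sub_mul_nonpos {d t t' : ℝ} (h : IsBestReply d t) (h0 : 0 ≤ t') (h1 : t' ≤ 1) :
    (t' - t) * d ≤ 0 := by
  rcases lt_trichotomy d 0 with hd | hd | hd
  · rw [h.2 hd]; nlinarith
  · simp [hd]
  · rw [h.1 hd]; nlinarith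

lemma isBestReply_of_forall {d t : ℝ} (h0 : 0 ≤ t) (h1 : t ≤ 1)
    (h : ∀ t', 0 ≤ t' → t' ≤ 1 → (t' - t) * d ≤ 0) : IsBestReply d t := by
  have hone := h 1 zero_le_one le_rfl
  have hzero := h 0 le_rfl zero_le_one
  constructor <;> intro hd <;> nlinarith

/-- In the gain from a deviation u and v enter only through the positive factor u + v, and w
cancels. Hence best replies depend only on the beliefs and on q. -/
lemma payoffAgainst_sub {a b q u v w : ℝ} (t₀ t₁ t₀' t₁' x₀ x₁ : ℝ) :
    payoffAgainst a b (mech q u v w) t₀' t₁' x₀ x₁ - payoffAgainst a b (mech q u v w) t₀ t₁ x₀ x₁ =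
      (u + v) * ((1 - b) * ((t₀' - t₀) * (belief a x₀ x₁ - q)) +
        a * ((t₁' - t₁) * (belief b x₀ x₁ - q))) / (1 - b + a) := by
  simp only [payoffAgainst, line_mech_zero, line_mech_one]
  ring

/-! ### Equilibria of the game are symmetric. -/

section Equilibrium

variable {A : Type*} [Fintype A] [DecidableEq A] [Nontrivial A] {Q : (A → Fin 2) → ℝ} {a b : ℝ}

lemma HasPosteriors.isEquilibrium_iff (hQ : HasPosteriors Q a b) {q u v w : ℝ} (huv : 0 < u + v)
    (θ : A → Strategy) : IsEquilibrium Q (mech q u v w) θ ↔ ∀ i,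
      IsBestReply (belief a (others θ i 0) (others θ i 1) - q) (θ i 0) ∧
      IsBestReply (belief b (others θ i 0) (others θ i 1) - q) (θ i 1) := by
  have hc : 0 < 1 - b + a := by linarith [hQ.pos, hQ.lt_one]
  have hdev : ∀ (i : A) (τ : Strategy),
      expectedPayoff Q (mech q u v w) (Function.update θ i τ) i ≤
        expectedPayoff Q (mech q u v w) θ i ↔
      (1 - b) * (((τ 0 : ℝ) - θ i 0) * (belief a (others θ i 0) (others θ i 1) - q)) +
        a * (((τ 1 : ℝ) - θ i 1) * (belief b (others θ i 0) (others θ i 1) - q)) ≤ 0 :=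
    fun i τ => by
      rw [hQ.expectedPayoff_eq, hQ.expectedPayoff_eq, others_update, Function.update_self,
        ← sub_nonpos, payoffAgainst_sub, div_le_iff₀ hc, zero_mul, ← mul_zero (u + v),
        mul_le_mul_iff_right₀ huv, mul_zero]
  simp only [IsEquilibrium, hdev]
  refine forall_congr' fun i => ⟨fun h => ⟨?_, ?_⟩, fun h τ => ?_⟩
  · refine isBestReply_of_forall (θ i 0).2.1 (θ i 0).2.2 fun t h0 h1 => ?_
    have := h fun s => if s = 0 then ⟨t, h0, h1⟩ else θ i 1
    simp only [Fin.isValue, if_true, one_ne_zero, if_false, sub_self, zero_mul, mul_zero,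
      add_zero] at this
    exact nonpos_of_mul_nonpos_right this (by linarith [hQ.lt_one])
  · refine isBestReply_of_forall (θ i 1).2.1 (θ i 1).2.2 fun t h0 h1 => ?_
    have := h fun s => if s = 0 then θ i 0 else ⟨t, h0, h1⟩
    simp only [Fin.isValue, if_true, one_ne_zero, if_false, sub_self, zero_mul, mul_zero,
      zero_add] at this
    exact nonpos_of_mul_nonpos_right this hQ.pos
  · have h0 := h.1.sub_mul_nonpos (τ 0).2.1 (τ 0).2.2
    have h1 := h.2.sub_mul_nonpos (τ 1).2.1 (τ 1).2.2
    have := mul_nonpos_of_nonneg_of_nonpos (sub_nonneg.mpr hQ.lt_one.le) h0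
    have := mul_nonpos_of_nonneg_of_nonpos hQ.pos.le h1
    linarith

/-- All agents play the same strategy in every equilibrium. -/
lemma HasPosteriors.eq_of_isEquilibrium (hQ : HasPosteriors Q a b) {q u v w : ℝ} (huv : 0 < u + v)
    {θ : A → Strategy} (hθ : IsEquilibrium Q (mech q u v w) θ) (i j : A) : θ i = θ j := by
  have hn : (0 : ℝ) < (Fintype.card A : ℝ) - 1 := by
    have : (1 : ℝ) < Fintype.card A := by exact_mod_cast Fintype.one_lt_card
    linarith
  rw [hQ.isEquilibrium_iff huv] at hθ
  have ha := hQ.pos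
  have hab := hQ.lt
  have hb := hQ.lt_one
  have hdiff : ∀ (i j : A) (p : ℝ),
      (belief p (others θ i 0) (others θ i 1) - belief p (others θ j 0) (others θ j 1)) *
        ((Fintype.card A : ℝ) - 1) =
      (1 - p) * ((θ j 0 : ℝ) - θ i 0) + p * ((θ j 1 : ℝ) - θ i 1) := fun i j p => by
    have h0 := others_sub_others θ i j 0
    have h1 := others_sub_others θ i j 1
    rw [eq_div_iff hn.ne'] at h0 h1
    rw [← h0, ← h1, belief, belief]
    ring
  -- If i reports 1 more often than j on signal s, optimality puts the belief of i at or above q and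
  -- that of j at or below q. But the opponents of i and j differ only in that i faces j and j faces
  -- i, so the belief difference is a multiple of the strategy difference with opposite sign.
  have hle : ∀ (i j : A) (p : ℝ) (s : Fin 2),
      (∀ i, IsBestReply (belief p (others θ i 0) (others θ i 1) - q) (θ i s)) →
      (θ j s : ℝ) < θ i s →
      0 ≤ (1 - p) * ((θ j 0 : ℝ) - θ i 0) + p * ((θ j 1 : ℝ) - θ i 1) := fun i j p s hp hlt => by
    rw [← hdiff]
    refine mul_nonneg ?_ hn.le
    have hi : q ≤ belief p (others θ i 0) (others θ i 1) := by
      by_contra hlt'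
      have := (hp i).2 (by linarith)
      linarith [(θ j s).2.1]
    have hj : belief p (others θ j 0) (others θ j 1) ≤ q := by
      by_contra hlt'
      have := (hp j).1 (by linarith)
      linarith [(θ i s).2.2]
    linarith
  -- If i exceeds j by d > 0 on signal 0, then j must exceed i by some d' > 0 on signal 1 with a d'
  -- ≥ (1 - a) d; the same argument on signal 1 gives (1 - b) d ≥ b d'. Together these contradict a
  -- < b.
  have h0 : ∀ i j : A, (θ i 0 : ℝ) ≤ θ j 0 := fun i j => by
    by_contra! hlt
    have e0 := hle i j a 0 (fun i => (hθ i).1) hlt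
    have hlt1 : (θ i 1 : ℝ) < θ j 1 := by
      by_contra! hge
      nlinarith
    have e1 := hle j i b 1 (fun i => (hθ i).2) hlt1
    nlinarith
  have h0eq : (θ i 0 : ℝ) = θ j 0 := le_antisymm (h0 i j) (h0 j i)
  have h1 : ∀ i j : A, (θ i 1 : ℝ) ≤ θ j 1 := fun i j => by
    by_contra! hlt
    have e1 := hle i j b 1 (fun i => (hθ i).2) hlt
    have : (θ i 0 : ℝ) = θ j 0 := le_antisymm (h0 i j) (h0 j i)
    nlinarith
  exact (Strategy.eq_iff _ _).mpr ⟨h0eq, le_antisymm (h1 i j) (h1 j i)⟩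

/-- The advantage of truth-telling over the symmetric profile `(x₀, x₁)`. -/
noncomputable def advantageOver (a b : ℝ) (h : Fin 2 → Fin 2 → ℝ) (x₀ x₁ : ℝ) : ℝ :=
  payoffAgainst a b h 0 1 0 1 - payoffAgainst a b h x₀ x₁ x₀ x₁

lemma HasPosteriors.mem_advantages_iff (hQ : HasPosteriors Q a b) {q u v w : ℝ} (huv : 0 < u + v)
    (y : ℝ) : y ∈ advantages Q (mech q u v w) ↔
      ∃ x₀ ∈ Set.Icc (0 : ℝ) 1, ∃ x₁ ∈ Set.Icc (0 : ℝ) 1,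
        IsBestReply (belief a x₀ x₁ - q) x₀ ∧ IsBestReply (belief b x₀ x₁ - q) x₁ ∧
        ¬ (x₀ = 0 ∧ x₁ = 1) ∧ ¬ (x₀ = 0 ∧ x₁ = 0) ∧ ¬ (x₀ = 1 ∧ x₁ = 1) ∧
        y = advantageOver a b (mech q u v w) x₀ x₁ := by
  have hext : ∀ (x : Strategy) (z : Strategy), (fun _ : A => x) = (fun _ : A => z) ↔
      (x 0 : ℝ) = z 0 ∧ (x 1 : ℝ) = z 1 := fun x z => by
    rw [← Strategy.eq_iff]
    exact ⟨fun h => congrFun h (Classical.arbitrary A), fun h => h ▸ rfl⟩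
  have htruth : ∀ i : A, expectedPayoff Q (mech q u v w) (fun _ => truthful) i =
      payoffAgainst a b (mech q u v w) 0 1 0 1 := fun i => by
    rw [hQ.expectedPayoff_eq, others_const, others_const]
    simp [truthful]
  constructor
  · rintro ⟨θ, hθ, hT, hZ, hO, i, rfl⟩
    have hconst : θ = fun _ => θ i := funext fun j => hQ.eq_of_isEquilibrium huv hθ j i
    have hbest := (hQ.isEquilibrium_iff huv θ).mp hθ i
    rw [hconst] at hbest hT hZ hO ⊢
    rw [Ne, hext] at hT hZ hO
    simp only [others_const] at hbest
    refine ⟨θ i 0, (θ i 0).2, θ i 1, (θ i 1).2, hbest.1, hbest.2, ?_, ?_, ?_, ?_⟩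
    · simpa [truthful] using hT
    · simpa [allZero] using hZ
    · simpa [allOne] using hO
    · rw [htruth, hQ.expectedPayoff_eq, others_const, others_const, advantageOver]
  · rintro ⟨x₀, h₀, x₁, h₁, hb₀, hb₁, hT, hZ, hO, rfl⟩
    refine ⟨fun _ s => if s = 0 then ⟨x₀, h₀⟩ else ⟨x₁, h₁⟩, ?_, ?_, ?_, ?_,
      Classical.arbitrary A, ?_⟩
    · rw [hQ.isEquilibrium_iff huv]
      intro i
      simp only [others_const]
      exact ⟨hb₀, hb₁⟩
    · rw [Ne, hext]; simpa [truthful] using hT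
    · rw [Ne, hext]; simpa [allZero] using hZ
    · rw [Ne, hext]; simpa [allOne] using hO
    · rw [htruth, hQ.expectedPayoff_eq, others_const, others_const, advantageOver]
      simp

end Equilibrium

/-! ### The six remaining equilibria. -/

section SymmetricEquilibria

/-- `1 - q(1|1) + q(1|0)` times the advantage over the profile "always lie". -/
def advLie (a b q u v : ℝ) : ℝ := (a + b - 1) * (v * (1 - q) - u * q)

/-- `1 - q(1|1) + q(1|0)` times the advantage over the equilibrium that mixes on signal `1` and
reports `0` on signal `0`. -/
noncomputable def advMixOneZero (a b q u v : ℝ) : ℝ := a * (b - q) * (v - u * ((1 - b) / b))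

/-- `1 - q(1|1) + q(1|0)` times the advantage over the equilibrium that mixes on signal `1` and
reports `1` on signal `0`. -/
noncomputable def advMixOneOne (a b q u v : ℝ) : ℝ :=
  (1 - b) * (q - a) * u + v * (a * (b - q) - (1 - b) * (1 - q) * ((b - a) / b))

/-- `1 - q(1|1) + q(1|0)` times the advantage over the equilibrium that mixes on signal `0` and
reports `0` on signal `1`. -/
noncomputable def advMixZeroZero (a b q u v : ℝ) : ℝ :=
  a * (b - q) * v + u * ((1 - b) * (q - a) - a * q * ((b - a) / (1 - a)))

/-- `1 - q(1|1) + q(1|0)` times the advantage over the equilibrium that mixes on signal `0` and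
reports `1` on signal `1`. -/
noncomputable def advMixZeroOne (a b q u v : ℝ) : ℝ :=
  (1 - b) * (q - a) * (u - v * (a / (1 - a)))

/-- `1 - q(1|1) + q(1|0)` times the advantage over the equilibrium that ignores the signals. -/
def advMixBoth (a b q u v : ℝ) : ℝ := (1 - b) * (q - a) * u + a * (b - q) * v

/-- The beliefs after the two signals may each lie below, at or above q. Three of the nine sign
patterns yield the excluded profiles; each of the others fixes the profile, a belief equal to q
determining the mixing probability. -/
lemma symmetric_equilibrium_cases {a b q x₀ x₁ : ℝ} (hab : a < b) (ha1 : a < 1)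
    (h₀ : x₀ ∈ Set.Icc (0 : ℝ) 1)
    (hb₀ : IsBestReply (belief a x₀ x₁ - q) x₀) (hb₁ : IsBestReply (belief b x₀ x₁ - q) x₁)
    (hT : ¬ (x₀ = 0 ∧ x₁ = 1)) (hZ : ¬ (x₀ = 0 ∧ x₁ = 0)) (hO : ¬ (x₀ = 1 ∧ x₁ = 1)) :
    (q ≤ 1 - a ∧ x₀ = 1 ∧ x₁ = 0) ∨ (x₀ = 0 ∧ b * x₁ = q) ∨ (x₀ = 1 ∧ b * (1 - x₁) = 1 - q) ∨
      (q ≤ 1 - a ∧ (1 - a) * x₀ = q ∧ x₁ = 0) ∨ ((1 - a) * (1 - x₀) = 1 - q ∧ x₁ = 1) ∨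
      (x₀ = q ∧ x₁ = q) := by
  simp only [IsBestReply, belief, sub_pos, sub_neg] at hb₀ hb₁
  rcases lt_trichotomy ((1 - a) * x₀ + a * x₁) q with h0 | h0 | h0
  · have e0 := hb₀.2 h0
    rcases lt_trichotomy ((1 - b) * x₀ + b * x₁) q with h1 | h1 | h1
    · exact absurd ⟨e0, hb₁.2 h1⟩ hZ
    · exact Or.inr (Or.inl ⟨e0, by rw [e0] at h1; linarith⟩)
    · exact absurd ⟨e0, hb₁.1 h1⟩ hT
  · rcases lt_trichotomy ((1 - b) * x₀ + b * x₁) q with h1 | h1 | h1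
    · have e1 := hb₁.2 h1
      rw [e1] at h0
      exact Or.inr (Or.inr (Or.inr (Or.inl ⟨by nlinarith [h₀.2], by linarith, e1⟩)))
    · have : (b - a) * (x₁ - x₀) = 0 := by linarith
      have e : x₁ = x₀ := by
        rcases mul_eq_zero.mp this with h | h <;> linarith
      rw [e] at h0 ⊢
      exact Or.inr (Or.inr (Or.inr (Or.inr (Or.inr ⟨by linarith, by linarith⟩))))
    · have e1 := hb₁.1 h1
      rw [e1] at h0
      exact Or.inr (Or.inr (Or.inr (Or.inr (Or.inl ⟨by linarith, e1⟩))))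
  · have e0 := hb₀.1 h0
    rcases lt_trichotomy ((1 - b) * x₀ + b * x₁) q with h1 | h1 | h1
    · have e1 := hb₁.2 h1
      rw [e0, e1] at h0
      exact Or.inl ⟨by linarith, e0, e1⟩
    · exact Or.inr (Or.inr (Or.inl ⟨e0, by rw [e0] at h1; linarith⟩))
    · exact absurd ⟨e0, hb₁.1 h1⟩ hO

variable {a b : ℝ} (q u v w : ℝ)

lemma advantageOver_one_zero :
    advantageOver a b (mech q u v w) 1 0 = advLie a b q u v / (1 - b + a) := by
  simp only [advantageOver, payoffAgainst, line_mech_zero, line_mech_one, belief, advLie]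
  ring

lemma advantageOver_zero_mix (hb : b ≠ 0) :
    advantageOver a b (mech q u v w) 0 (q / b) = advMixOneZero a b q u v / (1 - b + a) := by
  simp only [advantageOver, payoffAgainst, line_mech_zero, line_mech_one, belief, advMixOneZero]
  field_simp
  ring

lemma advantageOver_one_mix (hb : b ≠ 0) :
    advantageOver a b (mech q u v w) 1 (1 - (1 - q) / b) =
      advMixOneOne a b q u v / (1 - b + a) := by
  simp only [advantageOver, payoffAgainst, line_mech_zero, line_mech_one, belief, advMixOneOne]
  field_simp
  ring

lemma advantageOver_mix_zero (ha : 1 - a ≠ 0) :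
    advantageOver a b (mech q u v w) (q / (1 - a)) 0 =
      advMixZeroZero a b q u v / (1 - b + a) := by
  simp only [advantageOver, payoffAgainst, line_mech_zero, line_mech_one, belief, advMixZeroZero]
  field_simp
  ring

lemma advantageOver_mix_one (ha : 1 - a ≠ 0) :
    advantageOver a b (mech q u v w) (1 - (1 - q) / (1 - a)) 1 =
      advMixZeroOne a b q u v / (1 - b + a) := by
  simp only [advantageOver, payoffAgainst, line_mech_zero, line_mech_one, belief, advMixZeroOne]
  field_simp
  ring

lemma advantageOver_self :
    advantageOver a b (mech q u v w) q q = advMixBoth a b q u v / (1 - b + a) := by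
  simp only [advantageOver, payoffAgainst, line_mech_zero, line_mech_one, belief, advMixBoth]
  ring

end SymmetricEquilibria

/-! ### The set of advantages of a mechanism. -/

section Advantages

variable {A : Type*} [Fintype A] [DecidableEq A] [Nontrivial A] {Q : (A → Fin 2) → ℝ}
  {a b q u v : ℝ}

lemma HasPosteriors.advantages_cases (hQ : HasPosteriors Q a b) (huv : 0 < u + v) (w : ℝ) {y : ℝ}
    (hy : y ∈ advantages Q (mech q u v w)) :
    (q ≤ 1 - a ∧ y = advLie a b q u v / (1 - b + a)) ∨
    y = advMixOneZero a b q u v / (1 - b + a) ∨ y = advMixOneOne a b q u v / (1 - b + a) ∨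
    (q ≤ 1 - a ∧ y = advMixZeroZero a b q u v / (1 - b + a)) ∨
    y = advMixZeroOne a b q u v / (1 - b + a) ∨ y = advMixBoth a b q u v / (1 - b + a) := by
  have ha := hQ.pos
  have hab := hQ.lt
  have hb := hQ.lt_one
  have hb0 : b ≠ 0 := by linarith
  have ha0 : 1 - a ≠ 0 := by linarith
  obtain ⟨x₀, h₀, x₁, -, hb₀, hb₁, hT, hZ, hO, rfl⟩ := (hQ.mem_advantages_iff huv y).mp hy
  rcases symmetric_equilibrium_cases hab (by linarith) h₀ hb₀ hb₁ hT hZ hO with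
    ⟨hq, rfl, rfl⟩ | ⟨rfl, e⟩ | ⟨rfl, e⟩ | ⟨hq, e, rfl⟩ | ⟨e, rfl⟩ | ⟨rfl, rfl⟩
  · exact Or.inl ⟨hq, advantageOver_one_zero q u v w⟩
  · have : x₁ = q / b := by rw [eq_div_iff hb0]; linarith
    rw [this, advantageOver_zero_mix q u v w hb0]
    simp
  · have : x₁ = 1 - (1 - q) / b := by rw [← e]; field_simp; ring
    rw [this, advantageOver_one_mix q u v w hb0]
    simp
  · have : x₀ = q / (1 - a) := by rw [eq_div_iff ha0]; linarith
    rw [this, advantageOver_mix_zero q u v w ha0]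
    simp [hq]
  · have : x₀ = 1 - (1 - q) / (1 - a) := by rw [← e]; field_simp; ring
    rw [this, advantageOver_mix_one q u v w ha0]
    simp
  · rw [advantageOver_self]
    simp

/-- Against liars the beliefs are 1 - a and 1 - b. Since 1 - b < a < q, only q ≤ 1 - a is a
restriction. That equality is allowed is why the supremum in `R3` is not attained. -/
lemma HasPosteriors.advLie_mem (hQ : HasPosteriors Q a b) (huv : 0 < u + v) (w : ℝ)
    (haq : a < q) (hq : q ≤ 1 - a) :
    advLie a b q u v / (1 - b + a) ∈ advantages Q (mech q u v w) := by
  refine (hQ.mem_advantages_iff huv _).mpr ⟨1, by simp, 0, by simp, ?_, ?_, by simp, by simp,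
    by simp, (advantageOver_one_zero q u v w).symm⟩ <;>
  · have := hQ.one_lt_add
    simp only [IsBestReply, belief]
    constructor <;> intro <;> first | trivial | linarith

lemma HasPosteriors.advMixOneZero_mem (hQ : HasPosteriors Q a b) (huv : 0 < u + v) (w : ℝ)
    (haq : a < q) (hqb : q < b) :
    advMixOneZero a b q u v / (1 - b + a) ∈ advantages Q (mech q u v w) := by
  have ha := hQ.pos
  have hb : 0 < b := by linarith
  have hx : 0 < q / b := div_pos (by linarith) hb
  have hx1 : q / b < 1 := (div_lt_one hb).mpr hqb
  have hbq : b * (q / b) = q := mul_div_cancel₀ q hb.ne'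
  refine (hQ.mem_advantages_iff huv _).mpr ⟨0, by simp, q / b, ⟨hx.le, hx1.le⟩, ?_, ?_,
    by simp [hx1.ne], fun h => hx.ne' h.2, by simp, (advantageOver_zero_mix q u v w hb.ne').symm⟩
  · simp only [IsBestReply, belief]
    have := hQ.lt
    exact ⟨fun h => by nlinarith, fun _ => trivial⟩
  · simp [IsBestReply, belief, hbq]

lemma HasPosteriors.advMixZeroOne_mem (hQ : HasPosteriors Q a b) (huv : 0 < u + v) (w : ℝ)
    (haq : a < q) (hqb : q < b) :
    advMixZeroOne a b q u v / (1 - b + a) ∈ advantages Q (mech q u v w) := by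
  have hab := hQ.lt
  have hb := hQ.lt_one
  have ha : 0 < 1 - a := by linarith
  have hx : 0 < (1 - q) / (1 - a) := div_pos (by linarith) ha
  have hx1 : (1 - q) / (1 - a) < 1 := (div_lt_one ha).mpr (by linarith)
  have haq : (1 - a) * ((1 - q) / (1 - a)) = 1 - q := mul_div_cancel₀ _ ha.ne'
  refine (hQ.mem_advantages_iff huv _).mpr ⟨1 - (1 - q) / (1 - a),
    ⟨by linarith, by linarith⟩, 1, by simp, ?_, ?_,
    fun h => by linarith [h.1], by simp, fun h => by linarith [h.1],
    (advantageOver_mix_one q u v w ha.ne').symm⟩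
  · have : belief a (1 - (1 - q) / (1 - a)) 1 - q = 0 := by
      rw [belief]; linarith
    simp [IsBestReply, this]
  · simp only [IsBestReply, belief]
    exact ⟨fun _ => trivial, fun h => by nlinarith⟩

/-- There are at most six advantages, and one of them always occurs. -/
lemma HasPosteriors.isLeast_gap_mech (hQ : HasPosteriors Q a b) (huv : 0 < u + v) (w : ℝ)
    (haq : a < q) (hqb : q < b) :
    IsLeast (advantages Q (mech q u v w)) (gap Q (mech q u v w)) := by
  have hfin : (advantages Q (mech q u v w)).Finite := by
    refine Set.Finite.subset (s := {advLie a b q u v / (1 - b + a),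
      advMixOneZero a b q u v / (1 - b + a), advMixOneOne a b q u v / (1 - b + a),
      advMixZeroZero a b q u v / (1 - b + a), advMixZeroOne a b q u v / (1 - b + a),
      advMixBoth a b q u v / (1 - b + a)}) (Set.toFinite _) fun y hy => ?_
    rcases hQ.advantages_cases huv w hy with ⟨-, h⟩ | h | h | ⟨-, h⟩ | h | h <;> simp [h]
  have hne : (advantages Q (mech q u v w)).Nonempty := ⟨_, hQ.advMixOneZero_mem huv w haq hqb⟩
  exact ⟨hne.csInf_mem hfin, fun y hy => csInf_le hfin.bddBelow hy⟩

end Advantages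

/-! ### Which matrices come from strictly proper scoring rules. -/

lemma eq_mech {h : Fin 2 → Fin 2 → ℝ} {q : ℝ} (hq : line h 0 q = line h 1 q) :
    h = mech q (h 0 0 - h 1 0) (h 1 1 - h 0 1) (line h 0 q) := by
  have hq' := hq
  simp only [line] at hq'
  funext t r
  fin_cases t <;> fin_cases r <;>
  simp only [line, mech, payoffMatrix, Matrix.cons_val_zero, Matrix.cons_val_one, Fin.zero_eta,
    Fin.mk_one] <;> linarith

/-- A proper scoring rule whose expected score is the maximum of two strictly convex parabolas that
touch the expected payments of the two reports of `mech q u v w` in `a` and `b`. -/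
noncomputable def parabolicRule (a b q u v w ε : ℝ) (t : Fin 2) (p : ℝ) : ℝ :=
  if w - u * (p - q) + ε * (p - a) ^ 2 ≤ w + v * (p - q) + ε * (p - b) ^ 2 then
    mech q u v w t 1 + ε * ((p - b) ^ 2 + 2 * (p - b) * ((t : ℝ) - p))
  else mech q u v w t 0 + ε * ((p - a) ^ 2 + 2 * (p - a) * ((t : ℝ) - p))

lemma expectedScore_parabolicRule (a b q u v w ε p p' : ℝ) :
    expectedScore (parabolicRule a b q u v w ε) p p' =
      (if w - u * (p' - q) + ε * (p' - a) ^ 2 ≤ w + v * (p' - q) + ε * (p' - b) ^ 2 then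
        w + v * (p - q) + ε * (p - b) ^ 2 else w - u * (p - q) + ε * (p - a) ^ 2) -
      ε * (p - p') ^ 2 := by
  rw [expectedScore, parabolicRule, parabolicRule]
  split_ifs <;>
  simp only [mech, payoffMatrix, Matrix.cons_val_zero, Matrix.cons_val_one, Fin.isValue,
    Fin.val_zero, Fin.val_one, Nat.cast_zero, Nat.cast_one] <;> ring

/-- The prediction p' earns the value at p of the parabola selected at p', less ε(p - p')². The
truthful prediction selects the larger parabola at p and loses nothing. -/
lemma isStrictlyProper_parabolicRule (a b q u v w : ℝ) {ε : ℝ} (hε : 0 < ε) :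
    IsStrictlyProper (parabolicRule a b q u v w ε) := by
  intro p _ p' _ hne
  rw [expectedScore_parabolicRule, expectedScore_parabolicRule]
  have : 0 < ε * (p - p') ^ 2 := mul_pos hε (pow_pos_of_sq hne)
  split_ifs <;> simp only [sub_self] <;> nlinarith
where
  pow_pos_of_sq {p p' : ℝ} (hne : p' ≠ p) : 0 < (p - p') ^ 2 := by
    have := sub_ne_zero.mpr hne.symm
    positivity

section

variable {A : Type*} [Fintype A] [DecidableEq A] {Q : (A → Fin 2) → ℝ} {a b : ℝ}

lemma HasPosteriors.isPeerPrediction_mech (hQ : HasPosteriors Q a b) {q u v : ℝ} (w : ℝ)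
    (haq : a < q) (hqb : q < b) (huv : 0 < u + v) : IsPeerPrediction Q (mech q u v w) := by
  have hm : 0 < min (q - a) (b - q) := lt_min (by linarith) (by linarith)
  have hab : 0 < b - a := by linarith
  -- Small enough that the parabola of the wrong report stays below at a and at b: ε(b - a)² is less
  -- than (u + v)(q - a) and (u + v)(b - q), the distances of the lines there.
  set ε := (u + v) * min (q - a) (b - q) / (2 * (b - a) ^ 2) with hεdef
  have hε : 0 < ε := by positivity
  have hεm : ε * (b - a) ^ 2 = (u + v) * min (q - a) (b - q) / 2 := by
    rw [hεdef]; field_simp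
  have hpos := mul_pos huv hm
  have hl := mul_le_mul_of_nonneg_left (min_le_left (q - a) (b - q)) huv.le
  have hr := mul_le_mul_of_nonneg_left (min_le_right (q - a) (b - q)) huv.le
  refine ⟨parabolicRule a b q u v w ε, isStrictlyProper_parabolicRule a b q u v w hε,
    fun t r => ?_⟩
  fin_cases r
  · have : ¬ (w - u * (a - q) + ε * (a - a) ^ 2 ≤ w + v * (a - q) + ε * (a - b) ^ 2) := by
      rw [not_le]; nlinarith
    simp only [Fin.zero_eta, hQ.posterior_one_zero, parabolicRule, if_neg this]
    ring
  · have : w - u * (b - q) + ε * (b - a) ^ 2 ≤ w + v * (b - q) + ε * (b - b) ^ 2 := by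
      nlinarith
    simp only [Fin.mk_one, hQ.posterior_one_one, parabolicRule, if_pos this]
    ring

/-- Propriety at a against b, and at b against a, says that the line of report 0 is higher at a and
that of report 1 higher at b; so they cross in between. -/
lemma HasPosteriors.exists_eq_mech (hQ : HasPosteriors Q a b) {h : Fin 2 → Fin 2 → ℝ}
    (hh : IsPeerPrediction Q h) :
    ∃ q u v w, a < q ∧ q < b ∧ 0 < u + v ∧ h = mech q u v w := by
  obtain ⟨PS, hPS, heq⟩ := hh
  have ha := hQ.pos
  have hab := hQ.lt
  have hb := hQ.lt_one
  have hA : a ∈ Set.Icc (0 : ℝ) 1 := ⟨ha.le, by linarith⟩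
  have hB : b ∈ Set.Icc (0 : ℝ) 1 := ⟨by linarith, hb.le⟩
  have h1 := hPS a hA b hB hab.ne'
  have h2 := hPS b hB a hA hab.ne
  have hPS0 : ∀ t, PS t a = h t 0 := fun t => by rw [heq, hQ.posterior_one_zero]
  have hPS1 : ∀ t, PS t b = h t 1 := fun t => by rw [heq, hQ.posterior_one_one]
  simp only [expectedScore, hPS0, hPS1] at h1 h2
  set D := h 0 0 - h 1 0 + (h 1 1 - h 0 1) with hD
  have hDpos : 0 < D := by
    have : 0 < (b - a) * D := by rw [hD]; nlinarith
    exact pos_of_mul_pos_right this (by linarith)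
  have hDq : D * ((h 0 0 - h 0 1) / D) = h 0 0 - h 0 1 := mul_div_cancel₀ _ hDpos.ne'
  refine ⟨(h 0 0 - h 0 1) / D, _, _, _, ?_, ?_, hDpos, eq_mech ?_⟩
  · rw [lt_div_iff₀ hDpos, hD]; nlinarith
  · rw [div_lt_iff₀ hDpos, hD]; nlinarith
  · simp only [line]
    rw [hD] at hDq ⊢
    linear_combination -hDq

lemma mech_bounds {q u v w : ℝ} (h : ∀ t r : Fin 2, 0 ≤ mech q u v w t r ∧ mech q u v w t r ≤ 1) :
    u ≤ 1 ∧ v ≤ 1 ∧ (u + v) * q ≤ 1 ∧ (u + v) * (1 - q) ≤ 1 := by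
  have h00 := h 0 0
  have h01 := h 0 1
  have h10 := h 1 0
  have h11 := h 1 1
  simp only [mech, payoffMatrix, Matrix.cons_val_zero, Matrix.cons_val_one] at h00 h01 h10 h11
  refine ⟨?_, ?_, ?_, ?_⟩ <;> linarith

variable [Nontrivial A]

lemma HasPosteriors.gap_mech_le (hQ : HasPosteriors Q a b) {q u v : ℝ} (w : ℝ)
    (haq : a < q) (hqb : q < b) (huv : 0 < u + v) :
    gap Q (mech q u v w) ≤ min (advMixOneZero a b q u v) (advMixZeroOne a b q u v) / (1 - b + a) := by
  have hc : 0 < 1 - b + a := by linarith [hQ.pos, hQ.lt_one]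
  have hleast := hQ.isLeast_gap_mech huv w haq hqb
  rw [← min_div_div_right hc.le]
  exact le_min (hleast.2 (hQ.advMixOneZero_mem huv w haq hqb))
    (hleast.2 (hQ.advMixZeroOne_mem huv w haq hqb))

lemma HasPosteriors.gap_mech_le_of_le (hQ : HasPosteriors Q a b) {q u v : ℝ} (w : ℝ)
    (haq : a < q) (hqb : q < b) (huv : 0 < u + v) (hq : q ≤ 1 - a) :
    gap Q (mech q u v w) ≤ min (advLie a b q u v) (advMixZeroOne a b q u v) / (1 - b + a) := by
  have hc : 0 < 1 - b + a := by linarith [hQ.pos, hQ.lt_one]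
  have hleast := hQ.isLeast_gap_mech huv w haq hqb
  rw [← min_div_div_right hc.le]
  exact le_min (hleast.2 (hQ.advLie_mem huv w haq hq))
    (hleast.2 (hQ.advMixZeroOne_mem huv w haq hqb))

/-- The three other equilibria are dominated: `advMixBoth` by `advMixOneZero` since u ≥ 0,
`advMixOneOne` by `advMixZeroOne` since a + b > 1, and `advMixZeroZero` by `advLie` through the last
inequality in `hlie`. -/
lemma HasPosteriors.gap_mech_eq (hQ : HasPosteriors Q a b) {q u v : ℝ} (w : ℝ)
    (haq : a < q) (hqb : q < b) (hu : 0 ≤ u) (hv : 0 < v)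
    (hle : advMixZeroOne a b q u v ≤ advMixOneZero a b q u v)
    (hlie : q ≤ 1 - a → advMixZeroOne a b q u v ≤ advLie a b q u v ∧ u * (a / (1 - a)) ≤ v) :
    gap Q (mech q u v w) = advMixZeroOne a b q u v / (1 - b + a) := by
  have ha := hQ.pos
  have hab := hQ.lt
  have hb := hQ.lt_one
  have hk := hQ.one_lt_add
  have hc : 0 < 1 - b + a := by linarith
  have huv : 0 < u + v := by linarith
  have hb0 : 0 < b := by linarith
  have ha1 : 0 < 1 - a := by linarith
  have hleast := hQ.isLeast_gap_mech huv w haq hqb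
  refine le_antisymm (hleast.2 (hQ.advMixZeroOne_mem huv w haq hqb)) ?_
  have hboth : advMixOneZero a b q u v ≤ advMixBoth a b q u v := by
    have : advMixBoth a b q u v - advMixOneZero a b q u v =
        u * (1 - b) * q * ((b - a) / b) := by
      rw [advMixBoth, advMixOneZero]; field_simp; ring
    have : 0 ≤ u * (1 - b) * q * ((b - a) / b) :=
      mul_nonneg (mul_nonneg (mul_nonneg hu (by linarith)) (by linarith))
        (div_nonneg (by linarith) hb0.le)
    linarith
  have hone : advMixZeroOne a b q u v ≤ advMixOneOne a b q u v := by
    have : advMixOneOne a b q u v - advMixZeroOne a b q u v =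
        v * ((a + b - 1) / b) * (b - q + (q - a) * ((1 - b) / (1 - a))) := by
      rw [advMixOneOne, advMixZeroOne]; field_simp; ring
    have h1 : 0 ≤ (a + b - 1) / b := div_nonneg (by linarith) hb0.le
    have h2 : 0 ≤ (q - a) * ((1 - b) / (1 - a)) :=
      mul_nonneg (by linarith) (div_nonneg (by linarith) ha1.le)
    have := mul_nonneg (mul_nonneg hv.le h1) (by linarith : 0 ≤ b - q +
      (q - a) * ((1 - b) / (1 - a)))
    linarith
  have hzero : q ≤ 1 - a → advLie a b q u v ≤ advMixZeroZero a b q u v := fun hq => by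
    have : advMixZeroZero a b q u v - advLie a b q u v =
        (1 - b) * (1 - a - q) * (v - u * (a / (1 - a))) := by
      rw [advMixZeroZero, advLie]; field_simp; ring
    have := mul_nonneg (mul_nonneg (by linarith : 0 ≤ 1 - b) (by linarith : 0 ≤ 1 - a - q))
      (sub_nonneg.mpr (hlie hq).2)
    linarith
  rcases hQ.advantages_cases huv w hleast.1 with ⟨hq, h⟩ | h | h | ⟨hq, h⟩ | h | h <;>
    refine (div_le_div_of_nonneg_right ?_ hc.le).trans_eq h.symm
  · exact (hlie hq).1
  · exact hle
  · exact hone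
  · exact (hlie hq).1.trans (hzero hq)
  · exact le_rfl
  · exact hle.trans hboth

end

/-! ### Linear programs for a fixed crossing point. -/

section Bounds

/-- The largest value of `min (advMixOneZero a b q u v) (advMixZeroOne a b q u v)` under the
constraint `u ≤ 1`. -/
noncomputable def kappaFun (a b q : ℝ) : ℝ := (1 - b) * (b - q) * (q - a) / (b * (1 - q))

/-- The largest value of `min (advMixOneZero a b q u v) (advMixZeroOne a b q u v)` under the
constraint `(u + v) * q ≤ 1`. -/
noncomputable def iotaFun (a b q : ℝ) : ℝ :=
  a * (1 - b) * (b - q) * (q - a) / (q * (a * b - q * (a + b - 1)))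

/-- The largest value of `min (advLie a b q u v) (advMixZeroOne a b q u v)` under the constraint
`v ≤ 1`. -/
noncomputable def lambdaFun (a b q : ℝ) : ℝ :=
  (a + b - 1) * (1 - b) * (q - a) * (1 - a - q) / (a * (1 - a) * (q - (1 - b)))

/-- The largest value of `min (advLie a b q u v) (advMixZeroOne a b q u v)` under the constraint
`(u + v) * (1 - q) ≤ 1`. -/
noncomputable def muFun (a b q : ℝ) : ℝ :=
  (a + b - 1) * (1 - b) * (q - a) * (1 - a - q) /
    ((1 - q) * ((1 - b) * (q - a) + (a + b - 1) * (1 - a)))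

variable {a b q u v : ℝ}

lemma iota_den_pos (ha : 0 < a) (hab : a < b) (hb : b < 1) (hq : 0 < q) (hqb : q < b) :
    0 < a * b - q * (a + b - 1) := by
  have h1 : 0 < a * b * (1 - q) := mul_pos (mul_pos ha (by linarith)) (by linarith)
  have h2 : 0 < (1 - a) * (1 - b) * q := mul_pos (mul_pos (by linarith) (by linarith)) hq
  linarith

lemma mul_le_of_le_advMixOneZero {m : ℝ} (hb : 0 < b) (h : m ≤ advMixOneZero a b q u v) :
    m * b ≤ a * (b - q) * (v * b - u * (1 - b)) := by
  have := mul_le_mul_of_nonneg_right h hb.le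
  rw [advMixOneZero] at this
  refine this.trans_eq ?_
  field_simp

lemma mul_le_of_le_advMixZeroOne {m : ℝ} (ha : a < 1) (h : m ≤ advMixZeroOne a b q u v) :
    m * (1 - a) ≤ (1 - b) * (q - a) * (u * (1 - a) - v * a) := by
  have ha' : 0 < 1 - a := by linarith
  have := mul_le_mul_of_nonneg_right h ha'.le
  rw [advMixZeroOne] at this
  refine this.trans_eq ?_
  field_simp

/-- Linear programming duality: the positive weights on the two advantages are chosen so that v
cancels and only u ≤ 1 is needed. -/
lemma min_le_kappaFun (ha : 0 < a) (hab : a < b) (hb : b < 1) (haq : a < q) (hqb : q < b)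
    (hu : u ≤ 1) : min (advMixOneZero a b q u v) (advMixZeroOne a b q u v) ≤ kappaFun a b q := by
  set m := min (advMixOneZero a b q u v) (advMixZeroOne a b q u v)
  have h2 := mul_le_of_le_advMixOneZero (by linarith) (min_le_left _ _ : m ≤ _)
  have h5 := mul_le_of_le_advMixZeroOne (by linarith) (min_le_right _ _ : m ≤ _)
  have hα : 0 < b - q := by linarith
  have hβ : 0 < (1 - b) * (q - a) := mul_pos (by linarith) (by linarith)
  have e2 := mul_le_mul_of_nonneg_left h2 hβ.le
  have e5 := mul_le_mul_of_nonneg_left h5 (mul_pos (by linarith : 0 < b) hα).le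
  have hu' := mul_le_mul_of_nonneg_left hu (mul_pos hβ (mul_pos hα (sub_pos.mpr hab))).le
  rw [kappaFun, le_div_iff₀ (mul_pos (by linarith) (by linarith))]
  refine le_of_mul_le_mul_left ?_ (sub_pos.mpr hab)
  linarith

/-- Here the weights leave a multiple of u + v. -/
lemma min_le_iotaFun (ha : 0 < a) (hab : a < b) (hb : b < 1) (haq : a < q) (hqb : q < b)
    (huv : (u + v) * q ≤ 1) :
    min (advMixOneZero a b q u v) (advMixZeroOne a b q u v) ≤ iotaFun a b q := by
  set m := min (advMixOneZero a b q u v) (advMixZeroOne a b q u v)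
  have h2 := mul_le_of_le_advMixOneZero (by linarith) (min_le_left _ _ : m ≤ _)
  have h5 := mul_le_of_le_advMixZeroOne (by linarith) (min_le_right _ _ : m ≤ _)
  have hq : 0 < q := ha.trans haq
  have hα : 0 < a * (b - q) := mul_pos ha (by linarith)
  have hβ : 0 < (1 - b) * (q - a) := mul_pos (by linarith) (by linarith)
  have e2 := mul_le_mul_of_nonneg_left (mul_le_mul_of_nonneg_left h2 hβ.le) hq.le
  have e5 := mul_le_mul_of_nonneg_left (mul_le_mul_of_nonneg_left h5 hα.le) hq.le
  have hu' := mul_le_mul_of_nonneg_left huv (mul_pos hβ (mul_pos hα (sub_pos.mpr hab))).le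
  rw [iotaFun, le_div_iff₀ (mul_pos hq (iota_den_pos ha hab hb hq hqb))]
  refine le_of_mul_le_mul_left ?_ (sub_pos.mpr hab)
  linarith

/-- Here the weights make u cancel. -/
lemma min_le_lambdaFun (ha : 0 < a) (hb : b < 1) (hk : 1 < a + b)
    (haq : a < q) (hqa : q ≤ 1 - a) (hv : v ≤ 1) :
    min (advLie a b q u v) (advMixZeroOne a b q u v) ≤ lambdaFun a b q := by
  set m := min (advLie a b q u v) (advMixZeroOne a b q u v)
  have h1 : m ≤ (a + b - 1) * (v * (1 - q) - u * q) := min_le_left _ _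
  have h5 := mul_le_of_le_advMixZeroOne (by linarith) (min_le_right _ _ : m ≤ _)
  have hβ : 0 < (1 - b) * (q - a) := mul_pos (by linarith) (by linarith)
  have ha' : 0 < 1 - a := by linarith
  have hkq : 0 < (a + b - 1) * q := mul_pos (by linarith) (by linarith)
  have e1 := mul_le_mul_of_nonneg_left (mul_le_mul_of_nonneg_left h1 hβ.le) ha'.le
  have e5 := mul_le_mul_of_nonneg_left h5 hkq.le
  have hv' := mul_le_mul_of_nonneg_left hv (mul_nonneg (mul_nonneg (by linarith : 0 ≤ a + b - 1)
    hβ.le) (by linarith : 0 ≤ 1 - a - q))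
  rw [lambdaFun, le_div_iff₀ (mul_pos (mul_pos ha ha') (by linarith))]
  linarith

/-- Again the weights leave a multiple of u + v. -/
lemma min_le_muFun (hb : b < 1) (hk : 1 < a + b)
    (haq : a < q) (hqa : q ≤ 1 - a) (huv : (u + v) * (1 - q) ≤ 1) :
    min (advLie a b q u v) (advMixZeroOne a b q u v) ≤ muFun a b q := by
  set m := min (advLie a b q u v) (advMixZeroOne a b q u v)
  have h1 : m ≤ (a + b - 1) * (v * (1 - q) - u * q) := min_le_left _ _
  have h5 := mul_le_of_le_advMixZeroOne (by linarith) (min_le_right _ _ : m ≤ _)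
  have hβ : 0 < (1 - b) * (q - a) := mul_pos (by linarith) (by linarith)
  have ha' : 0 < 1 - a := by linarith
  have hq' : 0 < 1 - q := by linarith
  have hk' : 0 < a + b - 1 := by linarith
  have e1 := mul_le_mul_of_nonneg_left (mul_le_mul_of_nonneg_left h1 hβ.le) hq'.le
  have e5 := mul_le_mul_of_nonneg_left (mul_le_mul_of_nonneg_left h5 hk'.le) hq'.le
  have hv' := mul_le_mul_of_nonneg_left huv (mul_nonneg (mul_nonneg hk'.le hβ.le)
    (by linarith : 0 ≤ 1 - a - q))
  rw [muFun, le_div_iff₀ (mul_pos hq' (add_pos hβ (mul_pos hk' ha')))]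
  linarith

/-- In terms of s = 1 - q the function is a positive multiple of (2 - a - b) - s - (1 - a)(1 - b)/s,
which increases with q as long as s² ≥ (1 - a)(1 - b). -/
lemma kappaFun_le_kappaFun {q₀ : ℝ} (ha : 0 < a) (hab : a < b) (hb : b < 1)
    (hqb : q₀ < b) (hq : q ≤ q₀) (h : (1 - a) * (1 - b) ≤ (1 - q₀) ^ 2) :
    kappaFun a b q ≤ kappaFun a b q₀ := by
  have hb0 : 0 < b := ha.trans hab
  rw [kappaFun, kappaFun, div_le_div_iff₀ (mul_pos hb0 (by linarith)) (mul_pos hb0 (by linarith))]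
  have h1 : (1 - q₀) ^ 2 ≤ (1 - q) * (1 - q₀) := by
    rw [sq]; exact mul_le_mul_of_nonneg_right (by linarith) (by linarith)
  have := mul_nonneg (mul_nonneg (mul_nonneg hb0.le (by linarith : 0 ≤ 1 - b))
    (sub_nonneg.mpr hq)) (sub_nonneg.mpr (h.trans h1))
  linarith

/-- With D(q) = ab - q(a + b - 1), cross-multiplication leaves the factor q - q₀ and the factor (1 -
a)(1 - b) q q₀ - D(q) D(q₀), whose sign the hypothesis controls because D decreases. -/
lemma iotaFun_lt_iotaFun {q₀ : ℝ} (ha : 0 < a) (hab : a < b) (hb : b < 1) (hk : 1 < a + b)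
    (haq : a < q₀) (hqb : q < b) (hq : q₀ < q)
    (h : (a * b - q₀ * (a + b - 1)) ^ 2 ≤ (1 - a) * (1 - b) * q₀ ^ 2) :
    iotaFun a b q < iotaFun a b q₀ := by
  have hq₀ : 0 < q₀ := ha.trans haq
  have hd := iota_den_pos ha hab hb (hq₀.trans hq) hqb
  have hd₀ := iota_den_pos ha hab hb hq₀ (hq.trans hqb)
  rw [iotaFun, iotaFun, div_lt_div_iff₀ (mul_pos (hq₀.trans hq) hd) (mul_pos hq₀ hd₀)]
  have h1 : (a * b - q * (a + b - 1)) * (a * b - q₀ * (a + b - 1)) <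
      (a * b - q₀ * (a + b - 1)) ^ 2 := by
    rw [sq]
    refine mul_lt_mul_of_pos_right ?_ hd₀
    have := mul_lt_mul_of_pos_right hq (by linarith : 0 < a + b - 1)
    linarith
  have h2 : (1 - a) * (1 - b) * q₀ ^ 2 ≤ (1 - a) * (1 - b) * (q * q₀) := by
    refine mul_le_mul_of_nonneg_left ?_ (mul_nonneg (by linarith) (by linarith))
    rw [sq]; exact mul_le_mul_of_nonneg_right hq.le hq₀.le
  have := mul_pos (mul_pos (mul_pos ha (by linarith : 0 < 1 - b)) (sub_pos.mpr hq))
    (sub_pos.mpr (h1.trans_le (h.trans h2)))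
  linarith

lemma iotaFun_le_kappaFun (ha : 0 < a) (hab : a < b) (hb : b < 1) (haq : a < q) (hqb : q < b)
    (h : a * b * (1 - q) ^ 2 ≤ (1 - a) * (1 - b) * q ^ 2) : iotaFun a b q ≤ kappaFun a b q := by
  have hq : 0 < q := ha.trans haq
  have hd := iota_den_pos ha hab hb hq hqb
  rw [iotaFun, kappaFun, div_le_div_iff₀ (mul_pos hq hd) (mul_pos (by linarith) (by linarith))]
  have := mul_nonneg (mul_nonneg (mul_nonneg (by linarith : 0 ≤ 1 - b) (sub_nonneg.mpr hqb.le))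
    (sub_nonneg.mpr haq.le)) (sub_nonneg.mpr h)
  linarith

end Bounds

/-! ### The crossing point q* and the bound Δ*_a. -/

section CrossingPoint

variable {a b : ℝ}

/-- The crossing point of the mechanism `M1`. -/
noncomputable def crossing (a b : ℝ) : ℝ := √(a * b) / (√(a * b) + √((1 - a) * (1 - b)))

/-- Bounds the denominator of `crossing` by 1, so q* ≥ √(ab) and 1 - q* ≥ √((1 - a)(1 - b)); this
puts q* in the monotonicity ranges of both κ and ι. -/
lemma sqrt_add_sqrt_le_one (ha : 0 ≤ a) (hb : 0 ≤ b) (ha1 : a ≤ 1) (hb1 : b ≤ 1) :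
    √(a * b) + √((1 - a) * (1 - b)) ≤ 1 := by
  have h1 : √(a * b) ≤ (a + b) / 2 := by
    refine Real.sqrt_le_iff.mpr ⟨by linarith, ?_⟩
    linarith [sq_nonneg (a - b)]
  have h2 : √((1 - a) * (1 - b)) ≤ ((1 - a) + (1 - b)) / 2 := by
    refine Real.sqrt_le_iff.mpr ⟨by linarith, ?_⟩
    linarith [sq_nonneg (a - b)]
  linarith

variable (ha : 0 < a) (hab : a < b) (hb : b < 1)
include ha hab hb

lemma sqrt_pos_and_sq : 0 < √(a * b) ∧ √(a * b) ^ 2 = a * b ∧ 0 < √((1 - a) * (1 - b)) ∧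
    √((1 - a) * (1 - b)) ^ 2 = (1 - a) * (1 - b) := by
  have h1 : 0 < a * b := mul_pos ha (by linarith)
  have h2 : 0 < (1 - a) * (1 - b) := mul_pos (by linarith) (by linarith)
  exact ⟨Real.sqrt_pos.mpr h1, Real.sq_sqrt h1.le, Real.sqrt_pos.mpr h2, Real.sq_sqrt h2.le⟩

lemma lt_crossing : a < crossing a b := by
  obtain ⟨ht, ht2, hr, hr2⟩ := sqrt_pos_and_sq ha hab hb
  rw [crossing, lt_div_iff₀ (by linarith)]
  have : a * √((1 - a) * (1 - b)) < (1 - a) * √(a * b) := by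
    refine lt_of_pow_lt_pow_left₀ 2 (mul_pos (by linarith) ht).le ?_
    rw [mul_pow, mul_pow, ht2, hr2]
    have := mul_pos (mul_pos ha (by linarith : 0 < 1 - a)) (sub_pos.mpr hab)
    linarith
  linarith

lemma crossing_lt : crossing a b < b := by
  obtain ⟨ht, ht2, hr, hr2⟩ := sqrt_pos_and_sq ha hab hb
  rw [crossing, div_lt_iff₀ (by linarith)]
  have : (1 - b) * √(a * b) < b * √((1 - a) * (1 - b)) := by
    refine lt_of_pow_lt_pow_left₀ 2 (mul_pos (by linarith) hr).le ?_
    rw [mul_pow, mul_pow, ht2, hr2]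
    have := mul_pos (mul_pos (ha.trans hab) (by linarith : 0 < 1 - b)) (sub_pos.mpr hab)
    linarith
  linarith

lemma mul_le_one_sub_crossing_sq : (1 - a) * (1 - b) ≤ (1 - crossing a b) ^ 2 := by
  obtain ⟨ht, ht2, hr, hr2⟩ := sqrt_pos_and_sq ha hab hb
  have hle := sqrt_add_sqrt_le_one ha.le (by linarith) (by linarith) hb.le
  have h : 1 - crossing a b = √((1 - a) * (1 - b)) / (√(a * b) + √((1 - a) * (1 - b))) := by
    rw [crossing]; field_simp; ring
  rw [h]
  conv_lhs => rw [← hr2]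
  exact pow_le_pow_left₀ hr.le (by rw [le_div_iff₀ (by linarith)]; nlinarith) 2

lemma mul_le_crossing_sq : a * b ≤ crossing a b ^ 2 := by
  obtain ⟨ht, ht2, hr, hr2⟩ := sqrt_pos_and_sq ha hab hb
  have hle := sqrt_add_sqrt_le_one ha.le (by linarith) (by linarith) hb.le
  rw [crossing]
  conv_lhs => rw [← ht2]
  exact pow_le_pow_left₀ ht.le (by rw [le_div_iff₀ (by linarith)]; nlinarith) 2

lemma mul_one_sub_sq_le_of_crossing_le {q : ℝ} (h : crossing a b ≤ q) (hq : q ≤ 1) :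
    a * b * (1 - q) ^ 2 ≤ (1 - a) * (1 - b) * q ^ 2 := by
  obtain ⟨ht, ht2, hr, hr2⟩ := sqrt_pos_and_sq ha hab hb
  rw [crossing, div_le_iff₀ (by linarith)] at h
  rw [← ht2, ← hr2, ← mul_pow, ← mul_pow]
  exact pow_le_pow_left₀ (mul_nonneg ht.le (by linarith)) (by linarith) 2

/-- Rationalize the denominator: a + b - 1 = t² - r² with t = √(ab) and r = √((1 - a)(1 - b)). This
identifies q* with q*_{a,o}. -/
lemma crossing_mul_sub : a * b - crossing a b * (a + b - 1) =
    √(a * b) * √((1 - a) * (1 - b)) := by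
  obtain ⟨ht, ht2, hr, hr2⟩ := sqrt_pos_and_sq ha hab hb
  rw [crossing]
  set t := √(a * b)
  set r := √((1 - a) * (1 - b))
  have hk : a + b - 1 = t ^ 2 - r ^ 2 := by rw [ht2, hr2]; ring
  rw [hk, ← ht2]
  field_simp
  ring

lemma iotaFun_lt_of_crossing_le {q₀ q : ℝ} (hk : 1 < a + b) (h : crossing a b ≤ q₀) (hq : q₀ < q)
    (hqb : q < b) : iotaFun a b q < iotaFun a b q₀ := by
  have hlt := lt_crossing ha hab hb
  refine iotaFun_lt_iotaFun ha hab hb hk (hlt.trans_le h) hqb hq ?_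
  obtain ⟨ht, ht2, hr, hr2⟩ := sqrt_pos_and_sq ha hab hb
  have hcr := crossing_mul_sub ha hab hb
  have hsq := mul_le_crossing_sq ha hab hb
  have hd := iota_den_pos ha hab hb (ha.trans (hlt.trans_le h)) (hq.trans hqb)
  calc (a * b - q₀ * (a + b - 1)) ^ 2
      ≤ (a * b - crossing a b * (a + b - 1)) ^ 2 := by
        refine pow_le_pow_left₀ hd.le ?_ 2
        have := mul_le_mul_of_nonneg_right h (by linarith : 0 ≤ a + b - 1)
        linarith
    _ = (1 - a) * (1 - b) * (a * b) := by rw [hcr, mul_pow, ht2, hr2]; ring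
    _ ≤ (1 - a) * (1 - b) * q₀ ^ 2 := by
        refine mul_le_mul_of_nonneg_left (hsq.trans ?_) (mul_nonneg (by linarith) (by linarith))
        exact pow_le_pow_left₀ (ha.trans hlt).le h 2

lemma one_sub_crossing_sq : a * b * (1 - crossing a b) ^ 2 =
    (1 - a) * (1 - b) * crossing a b ^ 2 := by
  obtain ⟨ht, ht2, hr, hr2⟩ := sqrt_pos_and_sq ha hab hb
  rw [← ht2, ← hr2, crossing]
  field_simp
  ring

lemma iotaFun_crossing : iotaFun a b (crossing a b) = kappaFun a b (crossing a b) := by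
  have h1 := lt_crossing ha hab hb
  have h2 := crossing_lt ha hab hb
  have hd := iota_den_pos ha hab hb (ha.trans h1) h2
  have hsq := one_sub_crossing_sq ha hab hb
  set q := crossing a b
  rw [iotaFun, kappaFun, div_eq_div_iff (mul_pos (ha.trans h1) hd).ne'
    (mul_pos (ha.trans hab) (by linarith)).ne']
  linear_combination (1 - b) * (b - q) * (q - a) * hsq

/-- Left of q* use κ, which rises up to q*; right of q* use ι, which falls from the same value. -/
lemma min_le_kappaFun_crossing {q u v : ℝ} (hk : 1 < a + b) (haq : a < q) (hqb : q < b)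
    (hu : u ≤ 1) (huv : (u + v) * q ≤ 1) :
    min (advMixOneZero a b q u v) (advMixZeroOne a b q u v) ≤ kappaFun a b (crossing a b) := by
  rcases le_or_gt q (crossing a b) with h | h
  · exact (min_le_kappaFun ha hab hb haq hqb hu).trans
      (kappaFun_le_kappaFun ha hab hb (crossing_lt ha hab hb) h
        (mul_le_one_sub_crossing_sq ha hab hb))
  · rw [← iotaFun_crossing ha hab hb]
    exact (min_le_iotaFun ha hab hb haq hqb huv).trans
      (iotaFun_lt_of_crossing_le ha hab hb hk le_rfl h hqb).le

end CrossingPoint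

/-! ### The lying equilibrium, η and the bound Δ*_b. -/

section Eta

/-- The facts about `e = η(Q)` on which the analysis of the mechanism `M2` rests. -/
structure IsEta (a b e : ℝ) : Prop where
  lt : a < e * (1 - a)
  lt_one : e < 1
  mixing_pos : 0 < b * e - (1 - b)
  eq : (a + b - 1) * (1 - a) * (1 - e ^ 2) = (1 - b) * (e * (1 - a) - a) ^ 2
  sq_eq : a * (1 - a) * (b * e - (1 - b)) ^ 2 = (a + b - 1) * (b - a)
  sq_le : a * (1 - a) * (1 + e) ^ 2 ≤ 1

/-- The relation `eq` says that for q = e/(1 + e), u = e, v = 1 the advantages over lying and over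
mixing on signal 0 coincide. Completing the square in this quadratic equation for e yields `sq_eq`,
of which η is the root with positive square. The bound `sq_le` is what the monotonicity of λ and μ
requires. -/
lemma isEta {a b : ℝ} (ha : 0 < a) (hab : a < b) (hb : b < 1) (hk : 1 < a + b) (ha2 : a < 1 - a) :
    IsEta a b (1 / b * (√((b - a) * (b - (1 - a)) / ((1 - a) * a)) + (1 - b))) := by
  have hb0 : 0 < b := ha.trans hab
  have hP : 0 < a * (1 - a) := mul_pos ha (by linarith)
  have hR : 0 < b * (1 - b) := mul_pos hb0 (by linarith)
  have hx : 0 < (b - a) * (b - (1 - a)) / ((1 - a) * a) :=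
    div_pos (mul_pos (by linarith) (by linarith)) (by linarith)
  set σ := √((b - a) * (b - (1 - a)) / ((1 - a) * a)) with hσ
  have hσ0 : 0 < σ := Real.sqrt_pos.mpr hx
  have hσ2 : a * (1 - a) * σ ^ 2 = (a + b - 1) * (b - a) := by
    have h1a : 1 - a ≠ 0 := by linarith
    rw [hσ, Real.sq_sqrt hx.le]; field_simp; ring
  set e := 1 / b * (σ + (1 - b)) with he
  have hbe : b * e = σ + (1 - b) := by rw [he]; field_simp
  have h4P : 4 * (a * (1 - a)) < 1 := by
    have : 0 < (1 - 2 * a) ^ 2 := pow_pos (by linarith) 2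
    linarith
  have heq : (a + b - 1) * (1 - a) * (1 - e ^ 2) = (1 - b) * (e * (1 - a) - a) ^ 2 := by
    have hb' : b * ((a + b - 1) * (1 - a) * (1 - e ^ 2)) =
        b * ((1 - b) * (e * (1 - a) - a) ^ 2) := by
      have hσe : σ = b * e - (1 - b) := by linarith
      rw [hσe] at hσ2
      linear_combination -hσ2
    exact mul_left_cancel₀ hb0.ne' hb'
  have hlt1 : e < 1 := by
    -- Since (a + b - 1)(b - a) = a(1 - a) - b(1 - b), the squares times a(1 - a) differ by b(1 -
    -- b)(1 - 4a(1 - a)).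
    have : σ < 2 * b - 1 := by
      refine lt_of_pow_lt_pow_left₀ 2 (by linarith) ?_
      refine lt_of_mul_lt_mul_left ?_ hP.le
      rw [hσ2]
      have := mul_pos hR (sub_pos.mpr h4P)
      linarith
    refine lt_of_mul_lt_mul_left ?_ hb0.le
    linarith
  have hlt : a < e * (1 - a) := by
    have : a + b - 1 < (1 - a) * σ := by
      refine lt_of_pow_lt_pow_left₀ 2 (mul_pos (by linarith) hσ0).le ?_
      refine lt_of_mul_lt_mul_left ?_ ha.le
      have e1 : a * ((1 - a) * σ) ^ 2 = (1 - a) * ((a + b - 1) * (b - a)) := by rw [← hσ2]; ring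
      rw [e1]
      have := mul_pos (mul_pos (by linarith : 0 < a + b - 1) hb0) (by linarith : 0 < 1 - a - a)
      linarith
    refine lt_of_mul_lt_mul_left ?_ hb0.le
    have e2 : b * (e * (1 - a)) = (1 - a) * (σ + (1 - b)) := by rw [← hbe]; ring
    rw [e2]
    linarith
  have hsq : a * (1 - a) * (1 + e) ^ 2 ≤ 1 := by
    have h1 : 2 * (a * (1 - a)) * σ ≤ b - 2 * (a * (1 - a)) := by
      refine le_of_sq_le_sq ?_ (by linarith)
      have e1 : (2 * (a * (1 - a)) * σ) ^ 2 = 4 * (a * (1 - a)) * ((a + b - 1) * (b - a)) := by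
        rw [← hσ2]; ring
      rw [e1]
      have := mul_pos (mul_pos hb0 hb0) (sub_pos.mpr h4P)
      linarith
    have h2 : b * (1 + e) = 1 + σ := by linarith
    refine le_of_mul_le_mul_left ?_ (mul_pos hb0 hb0)
    have e3 : b * b * (a * (1 - a) * (1 + e) ^ 2) = a * (1 - a) * (1 + σ) ^ 2 := by
      rw [← h2]; ring
    rw [e3]
    linarith
  have hσe : σ = b * e - (1 - b) := by linarith
  exact ⟨hlt, hlt1, by rwa [← hσe], heq, by rwa [← hσe], hsq⟩
where
  le_of_sq_le_sq {x y : ℝ} (h : x ^ 2 ≤ y ^ 2) (hy : 0 ≤ y) : x ≤ y :=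
    le_of_pow_le_pow_left₀ two_ne_zero hy h

variable {a b e : ℝ} (ha : 0 < a) (hab : a < b) (hb : b < 1) (hk : 1 < a + b) (he : IsEta a b e)
include ha hab hb hk he

omit hab hb hk in
lemma IsEta.pos (ha1 : a < 1) : 0 < e :=
  pos_of_mul_pos_left (ha.trans he.lt) (by linarith)

lemma IsEta.lambdaFun_eq : lambdaFun a b (e / (1 + e)) = (a + b - 1) * (1 - e) := by
  have he0 : 0 < 1 + e := by linarith [he.pos ha (by linarith)]
  have hk' : 0 < a + b - 1 := by linarith
  have h1 : e / (1 + e) - a = (e * (1 - a) - a) / (1 + e) := by field_simp; ring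
  have h2 : 1 - a - e / (1 + e) = (1 - a - e * a) / (1 + e) := by field_simp; ring
  have h3 : e / (1 + e) - (1 - b) = (b * e - (1 - b)) / (1 + e) := by field_simp; ring
  have hpos := he.mixing_pos
  have ha1 : 0 < 1 - a := by linarith
  have key : (1 - b) * (e * (1 - a) - a) * (1 - a - e * a) =
      a * (1 - a) * (1 - e ^ 2) * (b * e - (1 - b)) := by
    refine mul_left_cancel₀ hk'.ne' ?_
    have hq : (a + b - 1) * (1 - a - e * a) = a * (e * (1 - a) - a) * (b * e - (1 - b)) := by
      linear_combination he.eq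
    linear_combination (1 - b) * (e * (1 - a) - a) * hq -
      a * (b * e - (1 - b)) * he.eq
  rw [lambdaFun, h1, h2, h3, div_eq_iff (by positivity)]
  field_simp
  linear_combination key

lemma IsEta.muFun_eq : muFun a b (e / (1 + e)) = (a + b - 1) * (1 - e) := by
  have he0 : 0 < 1 + e := by linarith [he.pos ha (by linarith)]
  have hk' : 0 < a + b - 1 := by linarith
  have h1 : e / (1 + e) - a = (e * (1 - a) - a) / (1 + e) := by field_simp; ring
  have h2 : 1 - a - e / (1 + e) = (1 - a - e * a) / (1 + e) := by field_simp; ring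
  have h3 : 1 - e / (1 + e) = 1 / (1 + e) := by field_simp; ring
  have hlt := sub_pos.mpr he.lt
  have hb' : 0 < 1 - b := by linarith
  have ha1 : 0 < 1 - a := by linarith
  rw [muFun, h1, h2, h3, div_eq_iff (by positivity)]
  field_simp
  linear_combination -he.eq

/-- In terms of s = q - (1 - b), λ is a positive multiple of a constant minus s + (a + b - 1)(b -
a)/s, so it decreases once s² ≥ (a + b - 1)(b - a). By `sq_le` this already holds at e/(1 + e). -/
lemma IsEta.lambdaFun_le {q : ℝ} (h : e / (1 + e) ≤ q) :
    lambdaFun a b q ≤ (a + b - 1) * (1 - e) := by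
  rw [← he.lambdaFun_eq ha hab hb hk]
  have he0 : 0 < 1 + e := by linarith [he.pos ha (by linarith)]
  have ha1 : 0 < 1 - a := by linarith
  have hP : 0 < a * (1 - a) := mul_pos ha ha1
  have h3 : e / (1 + e) - (1 - b) = (b * e - (1 - b)) / (1 + e) := by field_simp; ring
  have hw₀ : 0 < e / (1 + e) - (1 - b) := h3 ▸ div_pos he.mixing_pos he0
  have hsq : (a + b - 1) * (b - a) ≤ (e / (1 + e) - (1 - b)) ^ 2 := by
    rw [h3, div_pow, le_div_iff₀ (pow_pos he0 2), ← he.sq_eq]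
    have := mul_le_mul_of_nonneg_left he.sq_le (sq_nonneg (b * e - (1 - b)))
    linarith
  set y := e / (1 + e)
  rw [lambdaFun, lambdaFun, div_le_div_iff₀ (mul_pos hP (by linarith)) (mul_pos hP hw₀)]
  have h1 : (y - (1 - b)) ^ 2 ≤ (q - (1 - b)) * (y - (1 - b)) := by
    rw [sq]; exact mul_le_mul_of_nonneg_right (by linarith) hw₀.le
  have := mul_nonneg (mul_nonneg (mul_nonneg (mul_nonneg (by linarith : 0 ≤ a + b - 1)
    (by linarith : 0 ≤ 1 - b)) hP.le) (sub_nonneg.mpr h)) (sub_nonneg.mpr (hsq.trans h1))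
  linarith

/-- With y = e/(1 + e) and D(q) = a(1 - a) - (1 - b)(1 - q), cross-multiplication leaves the factors
y - q and (a + b - 1)(b - a)(1 - q)(1 - y) - D(q) D(y). The second is nonnegative at q = y by
`sq_le`, and moving q to the left only increases it. -/
lemma IsEta.muFun_le {q : ℝ} (haq : a < q) (h : q ≤ e / (1 + e)) :
    muFun a b q ≤ (a + b - 1) * (1 - e) := by
  rw [← he.muFun_eq ha hab hb hk]
  have he0 : 0 < 1 + e := by linarith [he.pos ha (by linarith)]
  have ha1 : 0 < 1 - a := by linarith
  have hP : 0 < a * (1 - a) := mul_pos ha ha1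
  have hb' : 0 < 1 - b := by linarith
  have hk' : 0 < (a + b - 1) * (1 - a) := mul_pos (by linarith) ha1
  have hw₀ : 1 - e / (1 + e) = 1 / (1 + e) := by field_simp; ring
  have hw₀' : 0 < 1 - e / (1 + e) := hw₀ ▸ div_pos one_pos he0
  have hsq : (a * (1 - a) - (1 - b) * (1 - e / (1 + e))) ^ 2 ≤
      (a + b - 1) * (b - a) * (1 - e / (1 + e)) ^ 2 := by
    have h1 : a * (1 - a) - (1 - b) * (1 - e / (1 + e)) =
        (a * (1 - a) * (1 + e) - (1 - b)) / (1 + e) := by rw [hw₀]; field_simp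
    rw [h1, hw₀, div_pow, div_pow, mul_div_assoc', one_pow, mul_one]
    refine div_le_div_of_nonneg_right ?_ (sq_nonneg _)
    set σ := b * e - (1 - b) with hσ
    have hb0 : 0 < b := by linarith
    have e1 : b * (a * (1 - a) * (1 + e) - (1 - b)) = a * (1 - a) * (σ * (b * (1 + e))) := by
      have : b * (1 + e) = 1 + σ := by rw [hσ]; ring
      rw [this]
      linear_combination (a * (1 - a)) * this - he.sq_eq
    have e2 : a * (1 - a) * (1 + e) - (1 - b) = a * (1 - a) * (σ * (1 + e)) :=
      mul_left_cancel₀ hb0.ne' (by rw [e1]; ring)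
    rw [e2, ← he.sq_eq]
    have := mul_le_mul_of_nonneg_left he.sq_le (mul_nonneg hP.le (sq_nonneg σ))
    linarith
  set y := e / (1 + e)
  have hden : ∀ q, (1 - b) * (q - a) + (a + b - 1) * (1 - a) =
      a * (1 - a) - (1 - b) * (1 - q) := fun q => by ring
  have hpos : ∀ q, a < q → 0 < a * (1 - a) - (1 - b) * (1 - q) := fun q hq => by
    rw [← hden]
    have := mul_pos hb' (sub_pos.mpr hq)
    linarith
  rw [muFun, muFun, hden, hden, div_le_div_iff₀ (mul_pos (by linarith) (hpos q haq))
    (mul_pos hw₀' (hpos y (by linarith)))]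
  have h1 : (a * (1 - a) - (1 - b) * (1 - q)) * (a * (1 - a) - (1 - b) * (1 - y)) ≤
      (a * (1 - a) - (1 - b) * (1 - y)) ^ 2 := by
    rw [sq]
    refine mul_le_mul_of_nonneg_right ?_ (hpos y (by linarith)).le
    have := mul_le_mul_of_nonneg_left h hb'.le
    linarith
  have h2 : (a + b - 1) * (b - a) * (1 - y) ^ 2 ≤
      (a + b - 1) * (b - a) * ((1 - q) * (1 - y)) := by
    refine mul_le_mul_of_nonneg_left ?_ (mul_nonneg (by linarith) (by linarith))
    rw [sq]; exact mul_le_mul_of_nonneg_right (by linarith) hw₀'.le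
  have := mul_nonneg (mul_nonneg (mul_nonneg (by linarith : 0 ≤ a + b - 1) hb'.le)
    (sub_nonneg.mpr h)) (sub_nonneg.mpr (h1.trans (hsq.trans h2)))
  linarith

lemma IsEta.min_le {q u v : ℝ} (haq : a < q) (hqa : q ≤ 1 - a) (hv : v ≤ 1)
    (huv : (u + v) * (1 - q) ≤ 1) :
    min (advLie a b q u v) (advMixZeroOne a b q u v) ≤ (a + b - 1) * (1 - e) := by
  rcases le_total q (e / (1 + e)) with h | h
  · exact (min_le_muFun hb hk haq hqa huv).trans (he.muFun_le ha hab hb hk haq h)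
  · exact (min_le_lambdaFun ha hb hk haq hqa hv).trans (he.lambdaFun_le ha hab hb hk h)

end Eta

/-! ### The explicit mechanisms, their gaps and the closed forms. -/

lemma payoffMatrix_eq_mech {q u v : ℝ} (h : q * (u + v) = 1) :
    payoffMatrix v (1 - u) 0 1 = mech q u v (v * q) := by
  unfold mech
  congr 1 <;> linarith

lemma payoffMatrix_one_eq_mech {q u : ℝ} (h : q * (1 + u) = u) :
    payoffMatrix 1 0 0 u = mech q u 1 q := by
  unfold mech
  congr 1 <;> linarith

section

variable {A : Type*} [Fintype A] [DecidableEq A] {Q : (A → Fin 2) → ℝ} {a b : ℝ}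
  (hQ : HasPosteriors Q a b)
include hQ

lemma HasPosteriors.mech_mem_normalizedMechanisms {q u v : ℝ} (haq : a < q) (hqb : q < b)
    (hu0 : 0 ≤ u) (hu : u ≤ 1) (hv0 : 0 < v) (hv : v ≤ 1) (h : q * (u + v) = 1) :
    mech q u v (v * q) ∈ normalizedMechanisms Q := by
  refine ⟨⟨hQ.isPeerPrediction_mech _ haq hqb (by linarith), ?_⟩, ⟨0, 1, ?_⟩, ⟨0, 0, ?_⟩⟩ <;>
    rw [← payoffMatrix_eq_mech h]
  · intro t r
    fin_cases t <;> fin_cases r <;> simp only [payoffMatrix, Matrix.cons_val_zero,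
      Matrix.cons_val_one, Fin.zero_eta, Fin.mk_one] <;> constructor <;> linarith
  · rfl
  · rfl

lemma HasPosteriors.mech_one_mem_normalizedMechanisms {q u : ℝ} (haq : a < q) (hqb : q < b)
    (hu0 : 0 ≤ u) (hu : u ≤ 1) (h : q * (1 + u) = u) :
    mech q u 1 q ∈ normalizedMechanisms Q := by
  refine ⟨⟨hQ.isPeerPrediction_mech _ haq hqb (by linarith), ?_⟩, ⟨0, 1, ?_⟩, ⟨1, 1, ?_⟩⟩ <;>
    rw [← payoffMatrix_one_eq_mech h]
  · intro t r
    fin_cases t <;> fin_cases r <;> simp only [payoffMatrix, Matrix.cons_val_zero,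
      Matrix.cons_val_one, Fin.zero_eta, Fin.mk_one] <;> constructor <;> linarith
  · rfl
  · rfl

lemma HasPosteriors.sqrt_mul : √((1 - a) * a * (1 - b) * b) =
    √(a * b) * √((1 - a) * (1 - b)) := by
  rw [← Real.sqrt_mul (mul_pos hQ.pos (hQ.pos.trans hQ.lt)).le]
  congr 1
  ring

lemma HasPosteriors.qStarA_eq : qStarA (posterior Q) = crossing a b := by
  have hk : a + b - 1 ≠ 0 := by linarith [hQ.one_lt_add]
  have hk' : b - (1 - a) ≠ 0 := by linarith [hQ.one_lt_add]
  have h := crossing_mul_sub hQ.pos hQ.lt hQ.lt_one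
  rw [qStarA, hQ.posterior_one_zero, hQ.posterior_one_one, hQ.posterior_zero_zero,
    hQ.posterior_zero_one, show a * (1 - b) * (1 - a) * b = (1 - a) * a * (1 - b) * b by ring,
    hQ.sqrt_mul, div_eq_iff hk']
  linarith

lemma HasPosteriors.deltaA_eq :
    deltaA (posterior Q) = kappaFun a b (crossing a b) / (1 - b + a) := by
  have ha := hQ.pos
  have hb := hQ.lt_one
  have hab := hQ.lt
  have hk := hQ.one_lt_add
  have h := crossing_mul_sub ha hab hb
  have hlt := crossing_lt ha hab hb
  rw [deltaA, hQ.posterior_one_zero, hQ.posterior_one_one, hQ.posterior_zero_zero,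
    hQ.posterior_zero_one, hQ.sqrt_mul, kappaFun, ← h]
  set q := crossing a b
  have h1 : (1 - a) * a - (a * b - q * (a + b - 1)) = (a + b - 1) * (q - a) := by ring
  have h2 : a * b - q * (a + b - 1) - (1 - b) * b = (a + b - 1) * (b - q) := by ring
  have h3 : a * b - q * (a + b - 1) + b - (1 - a) - a * b = (a + b - 1) * (1 - q) := by ring
  have h4 : b - (1 - a) = a + b - 1 := by ring
  have hk' : a + b - 1 ≠ 0 := by linarith
  have hq : 1 - q ≠ 0 := by linarith
  have hb0 : b ≠ 0 := by linarith
  have hc : 1 - b + a ≠ 0 := by linarith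
  rw [h1, h2, h3, h4]
  field_simp

lemma HasPosteriors.deltaB_eq :
    deltaB (posterior Q) = (a + b - 1) * (1 - eta (posterior Q)) / (1 - b + a) := by
  have ha := hQ.pos
  have hb := hQ.lt_one
  have hab := hQ.lt
  have hk := hQ.one_lt_add
  have hP : 0 < (1 - a) * a := mul_pos (by linarith) ha
  have hb0 : b ≠ 0 := by linarith
  have hc : 1 - b + a ≠ 0 := by linarith
  have hc' : a + (1 - b) ≠ 0 := by linarith
  have ha1 : 1 - a ≠ 0 := by linarith
  have hsqrt : √((1 - a) * a * (b - a) * (b - (1 - a))) =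
      (1 - a) * a * √((b - a) * (b - (1 - a)) / ((1 - a) * a)) := by
    rw [show (1 - a) * a * (b - a) * (b - (1 - a)) =
      ((1 - a) * a) ^ 2 * ((b - a) * (b - (1 - a)) / ((1 - a) * a)) by field_simp,
      Real.sqrt_mul (sq_nonneg _), Real.sqrt_sq hP.le]
  rw [deltaB, eta, hQ.posterior_one_zero, hQ.posterior_one_one, hQ.posterior_zero_zero,
    hQ.posterior_zero_one, hsqrt]
  field_simp
  ring

lemma HasPosteriors.iotaA_eq :
    iotaA (posterior Q) = iotaFun a b (1 - a) / (1 - b + a) := by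
  have ha := hQ.pos
  have hb := hQ.lt_one
  have hk := hQ.one_lt_add
  have hd := iota_den_pos ha hQ.lt hb (by linarith [hQ.lt] : 0 < 1 - a) (by linarith)
  have hd' : a * b - (b - (1 - a)) * (1 - a) ≠ 0 := by
    refine ne_of_gt (hd.trans_eq ?_); ring
  have ha1 : 1 - a ≠ 0 := by linarith [hQ.lt]
  have hc : 1 - b + a ≠ 0 := by linarith
  have hc' : a + (1 - b) ≠ 0 := by linarith
  rw [iotaA, hQ.posterior_one_zero, hQ.posterior_one_one, hQ.posterior_zero_zero,
    hQ.posterior_zero_one, iotaFun, div_mul_div_comm, div_div,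
    div_eq_div_iff (mul_ne_zero hc' (mul_ne_zero ha1 hd'))
      (mul_ne_zero (mul_ne_zero ha1 hd.ne') hc)]
  ring

lemma HasPosteriors.kappaA_eq :
    kappaA (posterior Q) = kappaFun a b (1 - a) / (1 - b + a) := by
  rw [kappaA, hQ.posterior_one_zero, hQ.posterior_one_one, hQ.posterior_zero_zero,
    hQ.posterior_zero_one, kappaFun, div_mul_div_comm, div_div]
  congr 1 <;> ring

lemma HasPosteriors.isEta_eta (ha2 : a < 1 - a) : IsEta a b (eta (posterior Q)) := by
  rw [eta, hQ.posterior_one_zero, hQ.posterior_one_one, hQ.posterior_zero_zero,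
    hQ.posterior_zero_one]
  exact isEta hQ.pos hQ.lt hQ.lt_one hQ.one_lt_add ha2

/-- Both constraints u ≤ 1 and (u + v)q ≤ 1 are tight at q*. -/
lemma HasPosteriors.M1_eq : ∃ v, 0 < v ∧ v < 1 ∧ crossing a b * (1 + v) = 1 ∧
    M1 (posterior Q) = mech (crossing a b) 1 v (v * crossing a b) := by
  have ha := hQ.pos
  have hb := hQ.lt_one
  have hab := hQ.lt
  obtain ⟨ht, ht2, hr, hr2⟩ := sqrt_pos_and_sq ha hab hb
  have hz : zeta (posterior Q) = √((1 - a) * (1 - b)) / √(a * b) := by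
    rw [zeta, hQ.posterior_one_zero, hQ.posterior_one_one, hQ.posterior_zero_zero,
      hQ.posterior_zero_one, Real.sqrt_div (mul_pos (by linarith) (by linarith)).le]
  have hq : crossing a b * (1 + √((1 - a) * (1 - b)) / √(a * b)) = 1 := by
    rw [crossing]
    field_simp
  refine ⟨_, div_pos hr ht, ?_, hq, ?_⟩
  · rw [div_lt_one ht]
    refine lt_of_pow_lt_pow_left₀ 2 ht.le ?_
    rw [ht2, hr2]
    linarith [hQ.one_lt_add]
  · rw [M1, hz, ← payoffMatrix_eq_mech hq, sub_self]

lemma HasPosteriors.M3_eq {ε : ℝ} (hε : 0 < 1 - a + ε) (hεb : 1 - a + ε < b) :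
    M3 (posterior Q) ε = mech (1 - a + ε)
      (a * b * (1 - (1 - a + ε)) / ((1 - a + ε) * (a * b - (1 - a + ε) * (a + b - 1))))
      ((1 - a) * (1 - b) / (a * b - (1 - a + ε) * (a + b - 1)))
      ((1 - a) * (1 - b) / (a * b - (1 - a + ε) * (a + b - 1)) * (1 - a + ε)) := by
  have hd := iota_den_pos hQ.pos hQ.lt hQ.lt_one hε hεb
  rw [M3, zetaEps, deltaEps, hQ.posterior_one_zero, hQ.posterior_one_one, hQ.posterior_zero_zero,
    hQ.posterior_zero_one]
  set q := 1 - a + ε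
  have hd1 : (1 - a) * (1 - b) * q + a * (b - b * q) = a * b - q * (a + b - 1) := by ring
  have hd2 : a * b * (q - 1) - (1 - a) * (1 - b) * q = -(a * b - q * (a + b - 1)) := by ring
  rw [hd1, hd2, ← payoffMatrix_eq_mech]
  · congr 1
    rw [mul_neg, div_neg, eq_sub_iff_add_eq, neg_add_eq_sub, ← sub_div,
      div_eq_one_iff_eq (mul_pos hε hd).ne']
    ring
  · rw [← mul_div_mul_left ((1 - a) * (1 - b)) _ hε.ne', ← add_div, mul_div_assoc',
      div_eq_one_iff_eq (mul_pos hε hd).ne']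
    ring

/-- The condition q* ≤ 1 - a is needed for u ≤ 1, that is, for δ(ε) ≥ 0. -/
lemma HasPosteriors.M3_mem (hcr : crossing a b ≤ 1 - a) {ε : ℝ} (hε : 0 < ε) (hεb : 1 - a + ε < b) :
    M3 (posterior Q) ε ∈ normalizedMechanisms Q := by
  have ha := hQ.pos
  have hb := hQ.lt_one
  have hab := hQ.lt
  have hk := hQ.one_lt_add
  have hlt := lt_crossing ha hab hb
  have hq : 0 < 1 - a + ε := by linarith
  have hd := iota_den_pos ha hab hb hq hεb
  rw [hQ.M3_eq hq hεb]
  set q := 1 - a + ε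
  have hab0 : 0 < a * b := mul_pos ha (by linarith)
  have hAB : 0 < (1 - a) * (1 - b) := mul_pos (by linarith) (by linarith)
  refine hQ.mech_mem_normalizedMechanisms (by linarith) hεb
    (div_nonneg (mul_pos hab0 (by linarith)).le (mul_pos hq hd).le) ?_ (div_pos hAB hd) ?_ ?_
  · rw [div_le_one (mul_pos hq hd)]
    have := mul_one_sub_sq_le_of_crossing_le ha hab hb (by linarith : crossing a b ≤ q)
      (by linarith)
    linarith
  · rw [div_le_one hd]
    have := mul_pos (by linarith : 0 < a + b - 1) (by linarith : 0 < 1 - q)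
    linarith
  · rw [← mul_div_mul_left ((1 - a) * (1 - b)) _ hq.ne', ← add_div, mul_div_assoc',
      div_eq_one_iff_eq (mul_pos hq hd).ne']
    ring

lemma HasPosteriors.M1_mem : M1 (posterior Q) ∈ normalizedMechanisms Q := by
  obtain ⟨v, hv0, hv1, hq, heq⟩ := hQ.M1_eq
  rw [heq]
  exact hQ.mech_mem_normalizedMechanisms (lt_crossing hQ.pos hQ.lt hQ.lt_one)
    (crossing_lt hQ.pos hQ.lt hQ.lt_one) zero_le_one le_rfl hv0 hv1.le hq

variable [Nontrivial A]

/-- The crossing point exceeds 1 - a, so lying is no equilibrium; u and v equalize the two mixing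
advantages while (u + v)q = 1. -/
lemma HasPosteriors.gap_M3 (hcr : crossing a b ≤ 1 - a) {ε : ℝ} (hε : 0 < ε)
    (hεb : 1 - a + ε < b) :
    gap Q (M3 (posterior Q) ε) = iotaFun a b (1 - a + ε) / (1 - b + a) := by
  have ha := hQ.pos
  have hb := hQ.lt_one
  have hab := hQ.lt
  have hlt := lt_crossing ha hab hb
  have hq : 0 < 1 - a + ε := by linarith
  have hd := iota_den_pos ha hab hb hq hεb
  have ha1 : 1 - a ≠ 0 := by linarith
  have hb0 : b ≠ 0 := by linarith
  rw [hQ.M3_eq hq hεb]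
  have haq : a < 1 - a + ε := by linarith
  have hnot : ¬ 1 - a + ε ≤ 1 - a := by linarith
  set q := 1 - a + ε
  have hab0 : 0 < a * b := mul_pos ha (by linarith)
  have hAB : 0 < (1 - a) * (1 - b) := mul_pos (by linarith) (by linarith)
  have hzero : advMixZeroOne a b q (a * b * (1 - q) / (q * (a * b - q * (a + b - 1))))
      ((1 - a) * (1 - b) / (a * b - q * (a + b - 1))) = iotaFun a b q := by
    rw [advMixZeroOne, iotaFun]
    have hd0 := hd.ne'
    have hq0 := hq.ne'
    set d := a * b - q * (a + b - 1)
    field_simp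
    ring
  have hone : advMixOneZero a b q (a * b * (1 - q) / (q * (a * b - q * (a + b - 1))))
      ((1 - a) * (1 - b) / (a * b - q * (a + b - 1))) = iotaFun a b q := by
    rw [advMixOneZero, iotaFun]
    have hd0 := hd.ne'
    have hq0 := hq.ne'
    set d := a * b - q * (a + b - 1)
    field_simp
    ring
  rw [hQ.gap_mech_eq _ haq hεb (div_pos (mul_pos hab0 (by linarith)) (mul_pos hq hd)).le
    (div_pos hAB hd) (by rw [hzero, hone]) (fun h => absurd h hnot), hzero]

lemma HasPosteriors.gap_M1 (hcr : 1 - a < crossing a b) :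
    gap Q (M1 (posterior Q)) = deltaA (posterior Q) := by
  have ha := hQ.pos
  have hb := hQ.lt_one
  have hab := hQ.lt
  have haq := lt_crossing ha hab hb
  have hqb := crossing_lt ha hab hb
  have hsq := one_sub_crossing_sq ha hab hb
  obtain ⟨v, hv0, hv1, hq, heq⟩ := hQ.M1_eq
  rw [heq, hQ.deltaA_eq]
  set q := crossing a b
  have hq0 : 0 < q := ha.trans haq
  have ha1 : 1 - a ≠ 0 := by linarith
  have hb0 : b ≠ 0 := by linarith
  have hq1 : 1 - q ≠ 0 := by linarith
  have hv : v = (1 - q) / q := by rw [eq_div_iff hq0.ne']; linarith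
  have hb1 : b * (1 - q) ≠ 0 := mul_ne_zero hb0 hq1
  have hzero : advMixZeroOne a b q 1 v = kappaFun a b q := by
    have h : (1 - v * (a / (1 - a))) * (b * (1 - q)) = b - q := by
      rw [hv]
      field_simp
      linear_combination -hsq
    rw [advMixZeroOne, kappaFun, eq_div_iff hb1]
    linear_combination (1 - b) * (q - a) * h
  have hone : advMixOneZero a b q 1 v = kappaFun a b q := by
    have h : a * (v - 1 * ((1 - b) / b)) * (b * (1 - q)) = (1 - b) * (q - a) := by
      rw [hv]
      field_simp
      linear_combination hsq
    rw [advMixOneZero, kappaFun, eq_div_iff hb1]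
    linear_combination (b - q) * h
  rw [hQ.gap_mech_eq _ haq hqb zero_le_one hv0 (by rw [hzero, hone])
    (fun h => absurd h (not_le.mpr hcr)), hzero]

lemma HasPosteriors.M2_mem_and_gap (ha2 : a < 1 - a) :
    M2 (posterior Q) ∈ normalizedMechanisms Q ∧
      gap Q (M2 (posterior Q)) = deltaB (posterior Q) := by
  have ha := hQ.pos
  have hb := hQ.lt_one
  have hab := hQ.lt
  have hk := hQ.one_lt_add
  have he := hQ.isEta_eta ha2
  rw [hQ.deltaB_eq]
  have hM : M2 (posterior Q) = payoffMatrix 1 0 0 (eta (posterior Q)) := rfl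
  rw [hM]
  set e := eta (posterior Q)
  have he0 := he.pos ha (by linarith)
  have he1 := he.lt_one
  have hee : 0 < 1 + e := by linarith
  have hq : e / (1 + e) * (1 + e) = e := div_mul_cancel₀ _ hee.ne'
  have haq : a < e / (1 + e) := by
    rw [lt_div_iff₀ hee]; linarith [he.lt]
  have hqh : e / (1 + e) < 1 / 2 := by
    rw [div_lt_div_iff₀ hee two_pos]; linarith
  have hqb : e / (1 + e) < b := by linarith
  have ha1 : 0 < 1 - a := by linarith
  have hb0 : b ≠ 0 := by linarith
  rw [payoffMatrix_one_eq_mech hq]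
  refine ⟨hQ.mech_one_mem_normalizedMechanisms haq hqb he0.le he1.le hq, ?_⟩
  have hzero : advMixZeroOne a b (e / (1 + e)) e 1 = (a + b - 1) * (1 - e) := by
    rw [advMixZeroOne]
    field_simp
    linear_combination -he.eq
  have hlie : advLie a b (e / (1 + e)) e 1 = (a + b - 1) * (1 - e) := by
    rw [advLie]
    field_simp
    ring
  have hone : (a + b - 1) * (1 - e) ≤ advMixOneZero a b (e / (1 + e)) e 1 := by
    have h : advMixOneZero a b (e / (1 + e)) e 1 = a * (b - (1 - b) * e) ^ 2 / (b * (1 + e)) := by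
      rw [advMixOneZero]
      field_simp
      ring
    rw [h, le_div_iff₀ (mul_pos (by linarith) hee)]
    refine le_of_mul_le_mul_left ?_ ha
    -- The difference of the two sides is exactly the sum of `h1` and `h2`; the equation for η is
    -- not involved.
    have h1 := sq_nonneg (a * e - b * (1 - b) * (1 + e))
    have h2 := mul_nonneg (mul_nonneg (mul_nonneg (mul_nonneg (by linarith : 0 ≤ b)
      (by linarith : 0 ≤ a + b - 1)) (by linarith : 0 ≤ 1 - b)) (by linarith : 0 ≤ b - a))
      (sq_nonneg (1 + e))
    linarith
  have hle : e * (a / (1 - a)) ≤ 1 := by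
    rw [mul_div_assoc', div_le_one ha1]
    have := mul_le_mul_of_nonneg_right he1.le ha.le
    linarith
  rw [hQ.gap_mech_eq _ haq hqb he0.le one_pos (by rwa [hzero])
    (fun _ => ⟨by rw [hzero, hlie], hle⟩), hzero]

/-- Only the two mixing equilibria enter, so the bound is valid in every region. -/
lemma HasPosteriors.gap_le_deltaA {h : Fin 2 → Fin 2 → ℝ} (hh : h ∈ boundedMechanisms Q) :
    gap Q h ≤ deltaA (posterior Q) := by
  have hc : 0 < 1 - b + a := by linarith [hQ.pos, hQ.lt_one]
  obtain ⟨q, u, v, w, haq, hqb, huv, rfl⟩ := hQ.exists_eq_mech hh.1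
  obtain ⟨hu, -, hq, -⟩ := mech_bounds hh.2
  rw [hQ.deltaA_eq]
  exact (hQ.gap_mech_le w haq hqb huv).trans (div_le_div_of_nonneg_right
    (min_le_kappaFun_crossing hQ.pos hQ.lt hQ.lt_one hQ.one_lt_add haq hqb hu hq) hc.le)

/-- The alternatives are q ≤ 1 - a and q > 1 - a. In the second one ι is strictly decreasing, hence
the strict inequality, and ι ≤ κ at 1 - a because q* ≤ 1 - a. -/
lemma HasPosteriors.gap_le_deltaB_or (ha2 : a < 1 - a) (hcr : crossing a b ≤ 1 - a)
    {h : Fin 2 → Fin 2 → ℝ} (hh : h ∈ boundedMechanisms Q) :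
    gap Q h ≤ deltaB (posterior Q) ∨ gap Q h < min (iotaA (posterior Q)) (kappaA (posterior Q)) := by
  have ha := hQ.pos
  have hab := hQ.lt
  have hb := hQ.lt_one
  have hk := hQ.one_lt_add
  have hc : 0 < 1 - b + a := by linarith
  obtain ⟨q, u, v, w, haq, hqb, huv, rfl⟩ := hQ.exists_eq_mech hh.1
  obtain ⟨-, hv, hq, hq'⟩ := mech_bounds hh.2
  rcases le_or_gt q (1 - a) with hqa | hqa
  · left
    rw [hQ.deltaB_eq]
    exact (hQ.gap_mech_le_of_le w haq hqb huv hqa).trans (div_le_div_of_nonneg_right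
      ((hQ.isEta_eta ha2).min_le ha hab hb hk haq hqa hv hq') hc.le)
  · right
    have hle := iotaFun_le_kappaFun ha hab hb ha2 (hqa.trans hqb)
      (mul_one_sub_sq_le_of_crossing_le ha hab hb hcr (by linarith))
    rw [hQ.iotaA_eq, hQ.kappaA_eq, min_eq_left (div_le_div_of_nonneg_right hle hc.le)]
    exact (hQ.gap_mech_le w haq hqb huv).trans_lt (div_lt_div_of_pos_right
      ((min_le_iotaFun ha hab hb haq hqb hq).trans_lt
        (iotaFun_lt_of_crossing_le ha hab hb hk hcr hqa hqb)) hc)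

lemma HasPosteriors.tendsto_gap_M3 (ha2 : a < 1 - a) (hcr : crossing a b ≤ 1 - a) :
    Tendsto (fun ε : ℝ => gap Q (M3 (posterior Q) ε)) (𝓝[>] 0)
      (𝓝 (min (iotaA (posterior Q)) (kappaA (posterior Q)))) := by
  have ha := hQ.pos
  have hab := hQ.lt
  have hb := hQ.lt_one
  have hk := hQ.one_lt_add
  have hc : 0 < 1 - b + a := by linarith
  have hle := iotaFun_le_kappaFun ha hab hb ha2 (by linarith)
    (mul_one_sub_sq_le_of_crossing_le ha hab hb hcr (by linarith))
  rw [hQ.iotaA_eq, hQ.kappaA_eq, min_eq_left (div_le_div_of_nonneg_right hle hc.le)]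
  have hd := iota_den_pos ha hab hb (by linarith : 0 < 1 - a) (by linarith)
  have hcont : ContinuousAt (fun ε : ℝ => iotaFun a b (1 - a + ε) / (1 - b + a)) 0 := by
    unfold iotaFun
    refine ContinuousAt.div_const (ContinuousAt.div (by fun_prop) (by fun_prop) ?_) _
    rw [add_zero]
    exact (mul_pos (by linarith) hd).ne'
  have hlim : Tendsto (fun ε : ℝ => iotaFun a b (1 - a + ε) / (1 - b + a)) (𝓝[>] 0)
      (𝓝 (iotaFun a b (1 - a) / (1 - b + a))) := by
    have := hcont.tendsto.mono_left (nhdsWithin_le_nhds (s := Set.Ioi 0))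
    rwa [add_zero] at this
  refine hlim.congr' ?_
  filter_upwards [Ioo_mem_nhdsGT (by linarith : (0 : ℝ) < b - (1 - a))] with ε hε
  exact (hQ.gap_M3 hcr hε.1 (by linarith [hε.2])).symm

end

/-! ### Suprema, and the comparison of the regions. -/

section

variable {A : Type*} [Fintype A] [DecidableEq A] {Q : (A → Fin 2) → ℝ}

lemma isLUB_gap {X : ℝ} (hle : ∀ h ∈ boundedMechanisms Q, gap Q h ≤ X)
    (hlub : ∀ Y, (∀ h ∈ normalizedMechanisms Q, gap Q h ≤ Y) → X ≤ Y) :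
    IsLUB (gap Q '' normalizedMechanisms Q) X ∧ IsLUB (gap Q '' boundedMechanisms Q) X := by
  refine ⟨⟨?_, fun Y hY => hlub Y fun h hh => hY ⟨h, hh, rfl⟩⟩,
    ⟨?_, fun Y hY => hlub Y fun h hh => hY ⟨h, hh.1, rfl⟩⟩⟩
  · rintro _ ⟨h, hh, rfl⟩
    exact hle h hh.1
  · rintro _ ⟨h, hh, rfl⟩
    exact hle h hh

lemma regions_trichotomy (q : Fin 2 → Fin 2 → ℝ) :
    (R1 q ∧ ¬ R2 q ∧ ¬ R3 q) ∨ (¬ R1 q ∧ R2 q ∧ ¬ R3 q) ∨ (¬ R1 q ∧ ¬ R2 q ∧ R3 q) := by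
  simp only [R1, R2, R3, ← not_le]
  tauto

end

end PeerPrediction

theorem mainTheorem4 {A : Type*} [Fintype A] [DecidableEq A] [Nontrivial A]
    (Q : (A → Fin 2) → ℝ) (hQ : Q ∈ stdSimplex ℝ (A → Fin 2))
    (hsymm : IsSymmetric Q) (hcorr : IsPositivelyCorrelated Q)
    (hasymm : IsSignalAsymmetric Q) (hlt : posterior Q 0 0 < posterior Q 1 1) :
    -- the prior lies in exactly one of the three regions
    ((R1 (posterior Q) ∧ ¬ R2 (posterior Q) ∧ ¬ R3 (posterior Q)) ∨
      (¬ R1 (posterior Q) ∧ R2 (posterior Q) ∧ ¬ R3 (posterior Q)) ∨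
      (¬ R1 (posterior Q) ∧ ¬ R2 (posterior Q) ∧ R3 (posterior Q))) ∧
    -- the minimum that defines the gap exists for every peer prediction mechanism
    (∀ h, IsPeerPrediction Q h → IsLeast (advantages Q h) (gap Q h)) ∧
    -- `Δ*(Q)` is the supremal gap, also over all mechanisms with payoffs in `[0, 1]`
    IsLUB (gap Q '' normalizedMechanisms Q) (optimalGap Q) ∧
    IsLUB (gap Q '' boundedMechanisms Q) (optimalGap Q) ∧
    -- region `R₁`
    (R1 (posterior Q) →
      M1 (posterior Q) ∈ normalizedMechanisms Q ∧ gap Q (M1 (posterior Q)) = optimalGap Q) ∧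
    -- region `R₂`
    (R2 (posterior Q) →
      M2 (posterior Q) ∈ normalizedMechanisms Q ∧ gap Q (M2 (posterior Q)) = optimalGap Q) ∧
    -- region `R₃`
    (R3 (posterior Q) →
      (∀ h ∈ boundedMechanisms Q, gap Q h ≠ optimalGap Q) ∧
      (∀ ε : ℝ, 0 < ε → posterior Q 0 0 + ε < posterior Q 1 1 →
        M3 (posterior Q) ε ∈ normalizedMechanisms Q) ∧
      Tendsto (fun ε : ℝ => gap Q (M3 (posterior Q) ε)) (𝓝[>] 0) (𝓝 (optimalGap Q))) := by
  have hP := hasPosteriors hQ hsymm hcorr hlt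
  have h00 := hP.posterior_zero_zero
  have hcr := hP.qStarA_eq
  have hR := regions_trichotomy (posterior Q)
  refine ⟨hR, fun h hh => ?_, ?_⟩
  · obtain ⟨q, u, v, w, haq, hqb, huv, rfl⟩ := hP.exists_eq_mech hh
    exact hP.isLeast_gap_mech huv w haq hqb
  have hopt : ∀ X, IsLUB (gap Q '' normalizedMechanisms Q) X → optimalGap Q = X := fun X hX =>
    hX.csSup_eq ⟨_, _, hP.M1_mem, rfl⟩
  rcases hR with ⟨h1, h2, h3⟩ | ⟨h1, h2, h3⟩ | ⟨h1, h2, h3⟩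
  · have hgap : gap Q (M1 (posterior Q)) = deltaA (posterior Q) := by
      refine hP.gap_M1 ?_
      rcases h1 with h | ⟨-, h, -⟩
      -- Here 1 - a ≤ a, while q* always exceeds a.
      · rw [← h00]
        exact h.trans_lt (lt_crossing hP.pos hP.lt hP.lt_one)
      · rwa [← h00, ← hcr]
    have hlub := isLUB_gap (fun h hh => hP.gap_le_deltaA hh)
      (fun Y hY => hgap ▸ hY _ hP.M1_mem)
    rw [hopt _ hlub.1]
    exact ⟨hlub.1, hlub.2, fun _ => ⟨hP.M1_mem, hgap⟩, fun h => absurd h h2,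
      fun h => absurd h h3⟩
  · have ha2 : posterior Q 1 0 < 1 - posterior Q 1 0 := by
      rw [← h00]
      rcases h2 with h | h <;> exact h.1
    obtain ⟨hmem, hgap⟩ := hP.M2_mem_and_gap ha2
    have hle : ∀ h ∈ boundedMechanisms Q, gap Q h ≤ deltaB (posterior Q) := fun h hh => by
      -- The first case is in fact void: the gap Δ*_b of `M2` is at most Δ*_a by `gap_le_deltaA`. It
      -- needs no separate refutation.
      rcases h2 with ⟨-, -, hlt'⟩ | ⟨-, hle, hmin⟩
      · exact (hP.gap_le_deltaA hh).trans hlt'.le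
      · rw [hcr, h00] at hle
        rcases hP.gap_le_deltaB_or ha2 hle hh with h' | h'
        · exact h'
        · exact h'.le.trans hmin
    have hlub := isLUB_gap hle (fun Y hY => hgap ▸ hY _ hmem)
    rw [hopt _ hlub.1]
    exact ⟨hlub.1, hlub.2, fun h => absurd h h1, fun _ => ⟨hmem, hgap⟩, fun h => absurd h h3⟩
  · obtain ⟨ha2, hle, hmin⟩ := id h3
    rw [h00] at ha2
    rw [hcr, h00] at hle
    have hlt' : ∀ h ∈ boundedMechanisms Q,
        gap Q h < min (iotaA (posterior Q)) (kappaA (posterior Q)) := fun h hh =>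
      (hP.gap_le_deltaB_or ha2 hle hh).elim (fun h' => h'.trans_lt hmin) id
    have hlim := hP.tendsto_gap_M3 ha2 hle
    have hM3 : ∀ ε : ℝ, 0 < ε → posterior Q 0 0 + ε < posterior Q 1 1 →
        M3 (posterior Q) ε ∈ normalizedMechanisms Q := fun ε hε hεb =>
      hP.M3_mem hle hε (by rwa [← h00])
    -- No mechanism attains the bound, so leastness comes from the limit of the gaps of `M3`.
    have hlub := isLUB_gap (fun h hh => (hlt' h hh).le) (fun Y hY => by
      refine le_of_tendsto hlim ?_
      filter_upwards [Ioo_mem_nhdsGT (sub_pos.mpr hlt)] with ε hε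
      exact hY _ (hM3 ε hε.1 (by linarith [hε.2])))
    rw [hopt _ hlub.1]
    exact ⟨hlub.1, hlub.2, fun h => absurd h h1, fun h => absurd h h2,
      fun _ => ⟨fun h hh => (hlt' h hh).ne, hM3, hlim⟩⟩
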